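/- \textbf{Model.} Let $f_1,f_2\ge 0$ be measurable functions on $\mathbb R_+=(0,\infty)$ such that $F(\mathrm du)=f_1(u_1)f_2(u_2)\,\mathrm du_1\mathrm du_2$ is a probability measure on $\mathbb R_+^2$, and assume $$v_i:=\int_{\mathbb R_+}u^2f_i(u)\,\mathrm du<\infty,\qquad i=1,2.$$ For $x\in\mathbb R^2$ and $u\in\mathbb R_+^2$ let $B(x,u)$ be the closed axis-parallel rectangle with centre $x$ and edge lengths $u_1,u_2$. For each $\rho>0$ let $\lambda_\rho>0$, let $F_\rho$ be the image of $F$ under $u\mapsto\rho u$, and let $N_\rho$ be a Poisson random measure on $\mathbb R^2\times\mathbb R_+^2$ with intensity measure $\lambda_\rho\,\mathrm dx\,F_\rho(\mathrm du)$ (the probability space may depend on $\rho$). Let $\mathcal M_P$ be the linear space of finite signed measures $\mu$ on $\mathbb R^2$ which have a continuous Lebesgue density $f_\mu$ satisfying $|f_\mu(x)|\le C_\mu e^{-c_\mu(|x_1|+|x_2|)}$ for all $x\in\mathbb R^2$, with some constants $C_\mu,c_\mu>0$. For $\mu\in\mathcal M_P$ put $$J_\rho(\mu):=\int_{\mathbb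 R^2\times\mathbb R_+^2}\mu(B(x,u))\,N_\rho(\mathrm dx,\mathrm du),\qquad \widetilde J_\rho(\mu):=J_\rho(\mu)-\mathbb E J_\rho(\mu).$$ \textbf{Theorem (finite variance case).} The integral defining $J_\rho(\mu)$ converges absolutely almost surely and $\mathbb E|J_\rho(\mu)|<\infty$, for all $\rho>0$ and $\mu\in\mathcal M_P$. For all $\mu,\nu\in\mathcal M_P$ the function $f_\mu f_\nu$ is integrable, and there exists a centred Gaussian random field $X=(X(\mu))_{\mu\in\mathcal M_P}$, linear in the sense that $X(a\mu+b\nu)=aX(\mu)+bX(\nu)$ almost surely for all $a,b\in\mathbb R$ and $\mu,\nu\in\mathcal M_P$, with covariance function $$C_X(\mu,\nu)=\int_{\mathbb R^2}f_\mu(x)f_\nu(x)\,\mathrm dx .$$ If $\lambda_\rho\to\infty$ as $\rho\to0$, then for every such field $X$ the finite-dimensional distributions of $$\left(\frac{\widetilde J_\rho(\mu)}{\rho^2\sqrt{\lambda_\rho v_1v_2}}\right)_{\mu\in\mathcal M_P}$$ converge weakly to those of $X$ as $\rho\to0$: for all $k$ and $\mu_1,\dots,\mu_k\in\mathcal M_P$,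 the random vector with entries $\widetilde J_\rho(\mu_j)/(\rho^2\sqrt{\lambda_\rho v_1v_2})$, $1\le j\le k$, converges in distribution to $(X(\mu_1),\dots,X(\mu_k))$. -/

import Mathlib

open MeasureTheory ProbabilityTheory Filter Topology
open scoped ENNReal

noncomputable section

namespace RandomBoxes

/-- The closed box in the plane with centre `x` and edge lengths `u.1`, `u.2`. -/
def box (x u : ℝ × ℝ) : Set (ℝ × ℝ) :=
  Set.Icc (x.1 - u.1 / 2) (x.1 + u.1 / 2) ×ˢ Set.Icc (x.2 - u.2 / 2) (x.2 + u.2 / 2)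

/-- The law `F(du) = f₁(u₁) f₂(u₂) du₁ du₂` of the edge lengths, carried by the open positive
quadrant. -/
def edgeLaw (f₁ f₂ : ℝ → ℝ) : Measure (ℝ × ℝ) :=
  ((volume : Measure (ℝ × ℝ)).restrict (Set.Ioi 0 ×ˢ Set.Ioi 0)).withDensity
    (fun u => ENNReal.ofReal (f₁ u.1 * f₂ u.2))

/-- The second moment `∫ u² f(u) du` over the positive half-line. -/
def secondMoment (f : ℝ → ℝ) : ℝ := ∫ u in Set.Ioi (0 : ℝ), u ^ 2 * f u

/-- The intensity measure `lam · dx F_ρ(du)` on pairs (centre, edge lengths), where `F_ρ` is the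
image of the law `F` of the edge lengths under `u ↦ ρ u`. -/
def intensity (F : Measure (ℝ × ℝ)) (lam ρ : ℝ) : Measure ((ℝ × ℝ) × (ℝ × ℝ)) :=
  ENNReal.ofReal lam • (volume : Measure (ℝ × ℝ)).prod (F.map (fun u => ρ • u))

/-- `N` is a Poisson random measure on `E` with intensity measure `n`, under the probability
measure `P`. -/
structure IsPoissonRandomMeasure {Ω E : Type*} [MeasurableSpace Ω] [MeasurableSpace E]
    (N : Ω → Measure E) (n : Measure E) (P : Measure Ω) : Prop where
  measurable : Measurable N
  map_eq_poisson : ∀ A : Set E, MeasurableSet A → n A ≠ ∞ →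
    P.map (fun ω => N ω A) = (poissonMeasure (n A).toNNReal).map (fun k : ℕ => (k : ℝ≥0∞))
  ae_eq_top : ∀ A : Set E, MeasurableSet A → n A = ∞ → ∀ᵐ ω ∂P, N ω A = ∞
  indep : ∀ (k : ℕ) (A : Fin k → Set E), (∀ i, MeasurableSet (A i)) →
    Pairwise (fun i j => Disjoint (A i) (A j)) → iIndepFun (fun i ω => N ω (A i)) P

/-- The cumulative volume `J(μ) = ∫ μ(B(x,u)) N(dx,du)`. -/
def J {Ω : Type*} (N : Ω → Measure ((ℝ × ℝ) × (ℝ × ℝ))) (μ : SignedMeasure (ℝ × ℝ)) (ω : Ω) : ℝ :=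
  ∫ p, μ (box p.1 p.2) ∂(N ω)

/-- The centred cumulative volume `J(μ) - E J(μ)`. -/
def centredJ {Ω : Type*} [MeasurableSpace Ω] (P : Measure Ω)
    (N : Ω → Measure ((ℝ × ℝ) × (ℝ × ℝ))) (μ : SignedMeasure (ℝ × ℝ)) (ω : Ω) : ℝ :=
  J N μ ω - ∫ ω', J N μ ω' ∂P

/-- `f` is a continuous density of the signed measure `μ` with respect to Lebesgue measure, and it
decays at least exponentially fast (in particular it is bounded). -/
structure IsGoodDensity (μ : SignedMeasure (ℝ × ℝ)) (f : ℝ × ℝ → ℝ) : Prop where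
  continuous : Continuous f
  integrable : Integrable f
  eq_withDensity : μ = (volume : Measure (ℝ × ℝ)).withDensityᵥ f
  decay : ∃ C > 0, ∃ c > 0, ∀ x : ℝ × ℝ, |f x| ≤ C * Real.exp (-c * (|x.1| + |x.2|))

/-- The linear space of signed measures on the plane having a continuous density that decays at
least exponentially fast. (Mathlib's signed measures are real-valued, hence of finite total
variation.) -/
def MP : Submodule ℝ (SignedMeasure (ℝ × ℝ)) where
  carrier := {μ | ∃ f, IsGoodDensity μ f}
  zero_mem' := ⟨0, continuous_const, integrable_zero _ _ _, (withDensityᵥ_zero).symm,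
    1, one_pos, 1, one_pos, fun x => by simpa using (Real.exp_pos _).le⟩
  add_mem' := by
    rintro μ ν ⟨f, hf⟩ ⟨g, hg⟩
    obtain ⟨C, hC, c, hc, hfb⟩ := hf.decay
    obtain ⟨D, hD, d, hd, hgb⟩ := hg.decay
    refine ⟨f + g, hf.continuous.add hg.continuous, hf.integrable.add hg.integrable, ?_,
      C + D, add_pos hC hD, min c d, lt_min hc hd, fun x => ?_⟩
    · rw [withDensityᵥ_add hf.integrable hg.integrable, ← hf.eq_withDensity,
        ← hg.eq_withDensity]
    · have hx : 0 ≤ |x.1| + |x.2| := by positivity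
      have h1 : Real.exp (-c * (|x.1| + |x.2|)) ≤ Real.exp (-(min c d) * (|x.1| + |x.2|)) :=
        Real.exp_le_exp.2 (mul_le_mul_of_nonneg_right (neg_le_neg (min_le_left c d)) hx)
      have h2 : Real.exp (-d * (|x.1| + |x.2|)) ≤ Real.exp (-(min c d) * (|x.1| + |x.2|)) :=
        Real.exp_le_exp.2 (mul_le_mul_of_nonneg_right (neg_le_neg (min_le_right c d)) hx)
      calc |(f + g) x| ≤ |f x| + |g x| := abs_add_le _ _
        _ ≤ C * Real.exp (-(min c d) * (|x.1| + |x.2|))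
            + D * Real.exp (-(min c d) * (|x.1| + |x.2|)) :=
          add_le_add ((hfb x).trans (mul_le_mul_of_nonneg_left h1 hC.le))
            ((hgb x).trans (mul_le_mul_of_nonneg_left h2 hD.le))
        _ = (C + D) * Real.exp (-(min c d) * (|x.1| + |x.2|)) := by ring
  smul_mem' := by
    rintro a μ ⟨f, hf⟩
    obtain ⟨C, hC, c, hc, hfb⟩ := hf.decay
    refine ⟨a • f, hf.continuous.const_smul a, hf.integrable.smul a, ?_,
      (|a| + 1) * C, by positivity, c, hc, fun x => ?_⟩
    · rw [withDensityᵥ_smul, ← hf.eq_withDensity]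
    · have h : |(a • f) x| = |a| * |f x| := by simp [abs_mul]
      rw [h, mul_assoc]
      exact mul_le_mul (by linarith) (hfb x) (abs_nonneg _) (by positivity)

/-- The (unique) continuous density `f_μ` of `μ` in the space `MP`. -/
def density (μ : MP) : ℝ × ℝ → ℝ := Classical.choose μ.2

theorem density_spec (μ : MP) : IsGoodDensity (μ : SignedMeasure (ℝ × ℝ)) (density μ) :=
  Classical.choose_spec μ.2

/-- `X` is a centred Gaussian linear random field on `MP` with covariance function `C`. -/
structure IsCentredGaussianLinearField {Ω : Type*} [MeasurableSpace Ω] (X : MP → Ω → ℝ)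
    (C : MP → MP → ℝ) (P : Measure Ω) : Prop where
  gaussian : IsGaussianProcess X P
  centred : ∀ μ, ∫ ω, X μ ω ∂P = 0
  covariance_eq : ∀ μ ν, covariance (X μ) (X ν) P = C μ ν
  linear : ∀ (a b : ℝ) (μ ν : MP),
    X (a • μ + b • ν) =ᵐ[P] fun ω => a * X μ ω + b * X ν ω

/-- Convergence of all finite-dimensional distributions of the random fields `Y i` on `T` to those
of `X`, along the filter `l`. -/
def TendstoFiniteDimensional {ι T Ω' : Type*} {Ω : ι → Type*} [∀ i, MeasurableSpace (Ω i)]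
    [MeasurableSpace Ω'] (Y : (i : ι) → T → Ω i → ℝ) (l : Filter ι) (X : T → Ω' → ℝ)
    (P : (i : ι) → Measure (Ω i)) [∀ i, IsProbabilityMeasure (P i)]
    (P' : Measure Ω') [IsProbabilityMeasure P'] : Prop :=
  ∀ (k : ℕ) (t : Fin k → T),
    TendstoInDistribution (fun i ω (j : Fin k) => Y i (t j) ω) l
      (fun ω (j : Fin k) => X (t j) ω) P P'

end RandomBoxes

end

noncomputable section

namespace RandomBoxes

/-! The characteristic functional of a centred Poisson integral is explicit
(`integral_cexp_centred`): its logarithm is `∫ (e^{ig} - 1 - ig) dn`. Since `J` and `X` are linear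
almost surely, the Cramér–Wold device and Lévy's theorem (`tendstoInDistribution_of_tendsto_cexp`)
reduce the claim to one measure `μ` with density `f`, for which the exponent must tend to `-½ ∫ f²`
(`tendsto_exponent`).

After the substitution `u ↦ ρu` the exponent is the integral of `λ (e^{it} - 1 - it)` against `dx
F(du)`, with `t = μ(B(x, ρu)) / (ρ² √(λ v₁ v₂))`. By continuity of `f`, `μ(B(x, ρu)) / ρ²` tends to
`f(x) u₁ u₂`; as `λ → ∞`, `t` tends to `0` and only the quadratic Taylor term survives. The
pointwise limit is `-f(x)² u₁² u₂² / (2 v₁ v₂)`, which integrates to `-½ ∫ f²`.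

The passage to the limit needs a majorant: `μ(B(x, ρu))²` is at most `ρ⁴ u₁² u₂²` times an
integrable function of `x`. This is `windowMass_sq_le` applied in each coordinate, and it is where
finite second moments suffice. The limit field is an isonormal process on `L²(ℝ²)` evaluated at the
densities (`exists_isonormal`). -/

theorem lintegral_natCast_poissonMeasure (r : NNReal) :
    ∫⁻ k : ℕ, (k : ℝ≥0∞) ∂poissonMeasure r = r := by
  have hw : ∑' n : ℕ, ENNReal.ofReal (Real.exp (-r) * r ^ n / n.factorial) = 1 := by
    rw [← ENNReal.ofReal_tsum_of_nonneg (fun n => by positivity)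
      (hasSum_one_poissonMeasure r).summable, (hasSum_one_poissonMeasure r).tsum_eq,
      ENNReal.ofReal_one]
  have hstep : ∀ n : ℕ, ENNReal.ofReal (Real.exp (-r) * r ^ (n + 1) / (n + 1).factorial) *
      ((n + 1 : ℕ) : ℝ≥0∞) =
      r * ENNReal.ofReal (Real.exp (-r) * r ^ n / n.factorial) := by
    intro n
    rw [← ENNReal.ofReal_natCast, ← ENNReal.ofReal_mul (by positivity),
      ← ENNReal.ofReal_coe_nnreal, ← ENNReal.ofReal_mul (by positivity)]
    congr 1
    rw [Nat.factorial_succ]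
    push_cast
    field_simp
    ring
  rw [poissonMeasure, lintegral_sum_measure]
  simp_rw [lintegral_smul_measure, lintegral_dirac, smul_eq_mul]
  rw [tsum_eq_zero_add' ENNReal.summable]
  simp_rw [hstep]
  rw [ENNReal.tsum_mul_left, hw]
  simp

theorem norm_cexp_ofReal_mul_I_sub_one_le (x : ℝ) :
    ‖Complex.exp (x * Complex.I) - 1‖ ≤ ‖x‖ := by
  rw [mul_comm]
  exact Real.norm_exp_I_mul_ofReal_sub_one_le

theorem integrable_cexp_sub_one {E : Type*} [MeasurableSpace E] {n : Measure E} {g : E → ℝ} (hg : Integrable g n) :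
    Integrable (fun p => Complex.exp (g p * Complex.I) - 1) n :=
  hg.mono (by have := hg.1; fun_prop) (ae_of_all _ fun p => norm_cexp_ofReal_mul_I_sub_one_le _)

/-! ### Poisson random measures: mean measure and characteristic functional. -/

namespace IsPoissonRandomMeasure

variable {Ω E : Type*} [MeasurableSpace Ω] [MeasurableSpace E] {N : Ω → Measure E}
  {n : Measure E} {P : Measure Ω}

theorem lintegral_apply [IsProbabilityMeasure P] (hN : IsPoissonRandomMeasure N n P) {A : Set E}
    (hA : MeasurableSet A) : ∫⁻ ω, N ω A ∂P = n A := by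
  have hNA : Measurable fun ω => N ω A := (Measure.measurable_coe hA).comp hN.measurable
  by_cases h : n A = ∞
  · rw [lintegral_congr_ae (hN.ae_eq_top A hA h), lintegral_const, h]
    simp
  · calc ∫⁻ ω, N ω A ∂P = ∫⁻ x, x ∂(P.map fun ω => N ω A) := (lintegral_map measurable_id hNA).symm
      _ = n A := by
        rw [hN.map_eq_poisson A hA h, lintegral_map (f := fun x : ℝ≥0∞ => x) measurable_id .of_discrete]
        exact (lintegral_natCast_poissonMeasure _).trans (ENNReal.coe_toNNReal h)

/-- Reading `N` as a kernel turns Campbell's formula and the almost sure integrability of `g` into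
Fubini statements for kernel composition. -/
theorem bind_eq [IsProbabilityMeasure P] (hN : IsPoissonRandomMeasure N n P) :
    P.bind (⟨N, hN.measurable⟩ : Kernel Ω E) = n := by
  ext A hA
  rw [Measure.bind_apply hA (Kernel.aemeasurable _)]
  exact hN.lintegral_apply hA

theorem ae_integrable [IsProbabilityMeasure P] (hN : IsPoissonRandomMeasure N n P)
    {g : E → ℝ} (hg : Integrable g n) : ∀ᵐ ω ∂P, Integrable g (N ω) := by
  rw [← hN.bind_eq] at hg
  exact Measure.ae_integrable_of_integrable_comp hg

theorem integrable_integral [IsProbabilityMeasure P] (hN : IsPoissonRandomMeasure N n P)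
    {g : E → ℝ} (hg : Integrable g n) : Integrable (fun ω => ∫ p, g p ∂N ω) P := by
  rw [← hN.bind_eq, Measure.comp_eq_comp_const_apply] at hg
  simpa using hg.integral_comp

theorem integral_integral [IsProbabilityMeasure P] (hN : IsPoissonRandomMeasure N n P)
    {g : E → ℝ} (hg : Integrable g n) : ∫ ω, ∫ p, g p ∂N ω ∂P = ∫ p, g p ∂n := by
  have hg' := hg
  rw [← hN.bind_eq, Measure.comp_eq_comp_const_apply] at hg'
  have h := Kernel.integral_comp hg'
  rw [← Measure.comp_eq_comp_const_apply, hN.bind_eq] at h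
  simpa using h.symm

theorem charFun_map_toReal_mul (hN : IsPoissonRandomMeasure N n P) {A : Set E}
    (hA : MeasurableSet A) (h : n A ≠ ∞) (c : ℝ) :
    charFun (P.map fun ω => (N ω A).toReal * c) 1 =
      Complex.exp (n.real A * (Complex.exp (c * Complex.I) - 1)) := by
  have hNA : Measurable fun ω => N ω A := (Measure.measurable_coe hA).comp hN.measurable
  have hm : Measurable fun x : ℝ≥0∞ => x.toReal * c := ENNReal.measurable_toReal.mul_const c
  have h1 : P.map (fun ω => (N ω A).toReal * c) =
      (poissonMeasure (n A).toNNReal).map fun k : ℕ => (k : ℝ) * c := by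
    have := Measure.map_map (μ := P) hm hNA
    rw [hN.map_eq_poisson A hA h, Measure.map_map hm .of_discrete] at this
    rw [Function.comp_def, Function.comp_def] at this
    simpa using this.symm
  have h2 := charFun_map_cast_poissonMeasure (n A).toNNReal c
  rw [charFun_apply, integral_map .of_discrete (by fun_prop)] at h2
  rw [h1, charFun_apply, integral_map .of_discrete (by fun_prop)]
  simp only [Real.inner_apply, mul_one] at h2 ⊢
  exact h2

/-- The level sets of `g` are disjoint, so their counts are independent Poisson variables and the
characteristic function factorises. -/
theorem integral_cexp_simpleFunc [IsProbabilityMeasure P] (hN : IsPoissonRandomMeasure N n P)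
    (g : SimpleFunc E ℝ) (hg : Integrable g n) :
    ∫ ω, Complex.exp ((∫ p, g p ∂N ω : ℝ) * Complex.I) ∂P =
      Complex.exp (∫ p, (Complex.exp (g p * Complex.I) - 1) ∂n) := by
  classical
  -- The zero level set may have infinite intensity; it contributes nothing to either side and is
  -- dropped.
  set s : Finset ℝ := g.range.filter (· ≠ 0) with hs
  set X : s → Ω → ℝ := fun c ω => (N ω (g ⁻¹' {c.1})).toReal * c.1 with hX
  have hXm : ∀ c, Measurable (X c) := fun c =>
    (((Measure.measurable_coe (g.measurableSet_fiber c.1)).comp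
      hN.measurable).ennreal_toReal).mul_const _
  have hfin : ∀ c : s, n (g ⁻¹' {c.1}) ≠ ∞ := fun c =>
    ((SimpleFunc.integrable_iff.1 hg) c.1 (Finset.mem_filter.1 c.2).2).ne
  have hsum : ∀ᵐ ω ∂P, ∫ p, g p ∂N ω = ∑ c, X c ω := by
    filter_upwards [hN.ae_integrable hg] with ω hω
    rw [← SimpleFunc.integral_eq_integral g hω, SimpleFunc.integral_eq,
      Finset.sum_coe_sort s (fun c => (N ω (g ⁻¹' {c})).toReal * c), hs, Finset.sum_filter]
    refine Finset.sum_congr rfl fun c _ => ?_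
    by_cases hc : c = 0 <;> simp [hc, measureReal_def]
  have hind : iIndepFun X P := by
    have e := s.equivFin
    have h1 := hN.indep s.card (fun i => g ⁻¹' {(e.symm i).1})
      (fun i => g.measurableSet_fiber _) (fun i j hij => by
        refine Disjoint.preimage g (Set.disjoint_singleton.2 fun h => hij ?_)
        exact e.symm.injective (Subtype.ext h))
    have h2 := (h1.precomp e.injective).comp (fun c x => x.toReal * c.1)
      (fun c => ENNReal.measurable_toReal.mul_const _)
    simpa [hX, Function.comp_def] using h2
  have hright : ∫ p, (Complex.exp (g p * Complex.I) - 1) ∂n =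
      ∑ c : s, (n.real (g ⁻¹' {c.1}) : ℂ) * (Complex.exp (c.1 * Complex.I) - 1) := by
    have h1 := SimpleFunc.map_integral (μ := n) g (fun x : ℝ => Complex.exp (x * Complex.I) - 1)
      hg (by simp)
    have h2 : Integrable (g.map (fun x : ℝ => Complex.exp (x * Complex.I) - 1)) n := by
      refine SimpleFunc.integrable_iff_finMeasSupp.2 ?_
      exact (SimpleFunc.integrable_iff_finMeasSupp.1 hg).map (by simp)
    rw [SimpleFunc.integral_eq_integral _ h2] at h1
    rw [Finset.sum_coe_sort s
      (fun c => (n.real (g ⁻¹' {c}) : ℂ) * (Complex.exp (c * Complex.I) - 1)), hs,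
      Finset.sum_filter]
    refine (h1.trans (Finset.sum_congr rfl fun c _ => ?_))
    by_cases hc : c = 0 <;> simp [hc]
  have hcf : charFun (P.map fun ω => ∑ c, X c ω) 1 = ∏ c, charFun (P.map (X c)) 1 := by
    rw [hind.charFun_map_fun_sum_eq_prod (fun c => (hXm c).aemeasurable), Finset.prod_apply]
  calc ∫ ω, Complex.exp ((∫ p, g p ∂N ω : ℝ) * Complex.I) ∂P
      = ∫ ω, Complex.exp ((∑ c, X c ω : ℝ) * Complex.I) ∂P :=
        integral_congr_ae (by filter_upwards [hsum] with ω hω; rw [hω])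
    _ = charFun (P.map fun ω => ∑ c, X c ω) 1 := by
        rw [charFun_apply, integral_map (by fun_prop) (by fun_prop)]
        simp
    _ = _ := by
        rw [hcf, hright, Complex.exp_sum]
        exact Finset.prod_congr rfl fun c _ =>
          hN.charFun_map_toReal_mul (g.measurableSet_fiber _) (hfin c) _

/-- The characteristic functional of a Poisson random measure. -/
theorem integral_cexp [IsProbabilityMeasure P] (hN : IsPoissonRandomMeasure N n P)
    {g : E → ℝ} (hgm : Measurable g) (hg : Integrable g n) :
    ∫ ω, Complex.exp ((∫ p, g p ∂N ω : ℝ) * Complex.I) ∂P =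
      Complex.exp (∫ p, (Complex.exp (g p * Complex.I) - 1) ∂n) := by
  -- Approximating from base point `0` gives `|G k| ≤ 2|g|`, a majorant under `n` and under almost
  -- every `N ω`.
  set G : ℕ → SimpleFunc E ℝ := SimpleFunc.approxOn g hgm Set.univ 0 (Set.mem_univ 0) with hG
  have hGi : ∀ k, Integrable (G k) n := fun k =>
    SimpleFunc.integrable_approxOn hgm hg (Set.mem_univ 0) (integrable_zero _ _ _) k
  have hGt : ∀ p, Tendsto (fun k => G k p) atTop (𝓝 (g p)) := fun p =>
    SimpleFunc.tendsto_approxOn hgm (Set.mem_univ 0) (by simp)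
  have hGb : ∀ k p, ‖G k p‖ ≤ ‖g p‖ + ‖g p‖ := fun k p =>
    SimpleFunc.norm_approxOn_zero_le hgm (Set.mem_univ 0) p k
  have hl : Tendsto (fun k => ∫ ω, Complex.exp ((∫ p, G k p ∂N ω : ℝ) * Complex.I) ∂P) atTop
      (𝓝 (∫ ω, Complex.exp ((∫ p, g p ∂N ω : ℝ) * Complex.I) ∂P)) := by
    refine tendsto_integral_of_dominated_convergence (fun _ => 1) (fun k => ?_)
      (integrable_const _) (fun k => ae_of_all _ fun ω => (Complex.norm_exp_ofReal_mul_I _).le) ?_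
    · have := (hN.integrable_integral (hGi k)).1
      fun_prop
    · filter_upwards [hN.ae_integrable hg] with ω hω
      have : Tendsto (fun k => ∫ p, G k p ∂N ω) atTop (𝓝 (∫ p, g p ∂N ω)) :=
        tendsto_integral_of_dominated_convergence (fun p => ‖g p‖ + ‖g p‖)
          (fun k => (G k).aestronglyMeasurable) (hω.norm.add hω.norm)
          (fun k => ae_of_all _ (hGb k)) (ae_of_all _ hGt)
      exact ((by fun_prop : Continuous fun x : ℝ => Complex.exp (x * Complex.I)).tendsto _).comp
        this
  have hr : Tendsto (fun k => ∫ p, (Complex.exp (G k p * Complex.I) - 1) ∂n) atTop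
      (𝓝 (∫ p, (Complex.exp (g p * Complex.I) - 1) ∂n)) := by
    refine tendsto_integral_of_dominated_convergence (fun p => ‖g p‖ + ‖g p‖)
      (fun k => (integrable_cexp_sub_one (hGi k)).1) (hg.norm.add hg.norm)
      (fun k => ae_of_all _ fun p => (norm_cexp_ofReal_mul_I_sub_one_le _).trans (hGb k p))
      (ae_of_all _ fun p => ?_)
    exact ((by fun_prop : Continuous fun x : ℝ => Complex.exp (x * Complex.I) - 1).tendsto _).comp
      (hGt p)
  refine tendsto_nhds_unique hl ?_
  simp_rw [fun k => hN.integral_cexp_simpleFunc (G k) (hGi k)]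
  exact (Complex.continuous_exp.tendsto _).comp hr

/-- The characteristic functional of a centred Poisson random measure. -/
theorem integral_cexp_centred [IsProbabilityMeasure P] (hN : IsPoissonRandomMeasure N n P)
    {g : E → ℝ} (hgm : Measurable g) (hg : Integrable g n) :
    ∫ ω, Complex.exp ((∫ p, g p ∂N ω - ∫ ω', ∫ p, g p ∂N ω' ∂P : ℝ) * Complex.I) ∂P =
      Complex.exp (∫ p, (Complex.exp (g p * Complex.I) - 1 - g p * Complex.I) ∂n) := by
  have hi : Integrable (fun p => (g p : ℂ) * Complex.I) n := hg.ofReal.mul_const _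
  rw [integral_sub (integrable_cexp_sub_one hg) hi, integral_mul_const,
    Complex.exp_sub, integral_complex_ofReal, ← hN.integral_cexp hgm hg,
    hN.integral_integral hg]
  simp_rw [Complex.ofReal_sub, sub_mul, Complex.exp_sub]
  exact integral_div _ _

end IsPoissonRandomMeasure

/-! ### One-dimensional window estimates for the weight `(1 + y²)⁻¹`. -/

/-- The integral of `(1 + y²)⁻¹` over the interval with centre `x` and length `w`. -/
def windowMass (x w : ℝ) : ℝ := ∫ y in Set.Icc (x - w / 2) (x + w / 2), (1 + y ^ 2)⁻¹

theorem windowMass_nonneg (x w : ℝ) : 0 ≤ windowMass x w :=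
  integral_nonneg fun y => by positivity

theorem windowMass_le_pi (x w : ℝ) : windowMass x w ≤ Real.pi := by
  rw [← integral_univ_inv_one_add_sq]
  exact setIntegral_le_integral integrable_inv_one_add_sq (ae_of_all _ fun y => by positivity)

theorem windowMass_le_mul {x w C : ℝ} (hw : 0 ≤ w)
    (hC : ∀ y ∈ Set.Icc (x - w / 2) (x + w / 2), (1 + y ^ 2)⁻¹ ≤ C) :
    windowMass x w ≤ C * w := by
  have h := setIntegral_mono_on (μ := volume) (integrable_inv_one_add_sq.integrableOn)
    (integrableOn_const (C := C) (s := Set.Icc (x - w / 2) (x + w / 2)) (by simp))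
    measurableSet_Icc hC
  refine h.trans (le_of_eq ?_)
  rw [setIntegral_const, Real.volume_real_Icc_of_le (by linarith), smul_eq_mul]
  ring

theorem windowMass_le_self (x : ℝ) {w : ℝ} (hw : 0 ≤ w) : windowMass x w ≤ w := by
  have := windowMass_le_mul (x := x) hw (C := 1) fun y _ =>
    inv_le_one_of_one_le₀ (by nlinarith [sq_nonneg y])
  linarith

theorem windowMass_le_of_le_abs {x w : ℝ} (hw : 0 ≤ w) (hx : w ≤ |x|) :
    windowMass x w ≤ 4 * (1 + x ^ 2)⁻¹ * w := by
  refine windowMass_le_mul hw fun y hy => ?_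
  rw [← div_eq_mul_inv, ← one_div, div_le_div_iff₀ (by positivity) (by positivity)]
  have : |x| ≤ 2 * |y| := by
    cases abs_cases x <;> cases abs_cases y <;> linarith [hy.1, hy.2]
  nlinarith [sq_abs x, sq_abs y, abs_nonneg x, abs_nonneg y]

/-- If `w ≤ |x|`, every `y` in the window has `|x| ≤ 2|y|`. Otherwise `x² ≤ w²`, and the bounds `w`
and `π ≤ 4` together control the mass times `1 + x²`. This gives the integrability of box integrals.
-/
theorem windowMass_le (x : ℝ) {w : ℝ} (hw : 0 ≤ w) :
    windowMass x w ≤ 4 * (w + w ^ 2) * (1 + x ^ 2)⁻¹ := by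
  rcases le_or_gt w |x| with h | h
  · refine (windowMass_le_of_le_abs hw h).trans ?_
    have : 0 ≤ (1 + x ^ 2)⁻¹ := by positivity
    nlinarith [mul_nonneg this (sq_nonneg w)]
  · rw [← div_eq_mul_inv, le_div_iff₀ (by positivity)]
    have h0 := windowMass_nonneg x w
    have h1 := windowMass_le_self x hw
    have h2 := (windowMass_le_pi x w).trans Real.pi_le_four
    have h3 : x ^ 2 ≤ w ^ 2 := sq_le_sq' (by linarith [neg_abs_le x]) (by linarith [le_abs_self x])
    nlinarith [mul_le_mul h2 h3 (sq_nonneg x) (by norm_num)]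

/-- Homogeneity of degree two in `w` is the point: with `w = ρu` the factor `ρ²` cancels against the
normalisation, leaving a majorant free of `ρ`. The constant is `17 = 1 + 4²`, from the case `|x| <
w`. -/
theorem windowMass_sq_le (x : ℝ) {w : ℝ} (hw : 0 ≤ w) :
    windowMass x w ^ 2 ≤ 17 * w ^ 2 * (1 + x ^ 2)⁻¹ := by
  have h0 := windowMass_nonneg x w
  have h1 := windowMass_le_self x hw
  rcases le_or_gt w |x| with h | h
  · have h4 := windowMass_le_of_le_abs hw h
    have : 0 ≤ (1 + x ^ 2)⁻¹ := by positivity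
    calc windowMass x w ^ 2 = windowMass x w * windowMass x w := sq _
      _ ≤ w * (4 * (1 + x ^ 2)⁻¹ * w) := mul_le_mul h1 h4 h0 hw
      _ ≤ _ := by nlinarith [mul_nonneg this (sq_nonneg w)]
  · rw [← div_eq_mul_inv, le_div_iff₀ (by positivity)]
    have h2 := (windowMass_le_pi x w).trans Real.pi_le_four
    have h3 : x ^ 2 ≤ w ^ 2 := sq_le_sq' (by linarith [neg_abs_le x]) (by linarith [le_abs_self x])
    have h5 : windowMass x w ^ 2 ≤ w ^ 2 := pow_le_pow_left₀ h0 h1 2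
    have h6 : windowMass x w ^ 2 ≤ 4 ^ 2 := pow_le_pow_left₀ h0 h2 2
    nlinarith [mul_le_mul h6 h3 (sq_nonneg x) (by norm_num)]

/-- Exponential decay is only used through this weight. The term `2 / c²` is chosen so that its
product with the quadratic Taylor term of `exp (c|y|)` is `y²`. -/
theorem exp_neg_mul_abs_le {c : ℝ} (hc : 0 < c) (y : ℝ) :
    Real.exp (-c * |y|) ≤ (1 + 2 / c ^ 2) * (1 + y ^ 2)⁻¹ := by
  have h1 := Real.quadratic_le_exp_of_nonneg (x := c * |y|) (by positivity)
  rw [neg_mul, Real.exp_neg, ← div_eq_mul_inv, ← one_div,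
    div_le_div_iff₀ (Real.exp_pos _) (by positivity)]
  have h2 : (1 + 2 / c ^ 2) * (1 + c * |y| + (c * |y|) ^ 2 / 2) =
      1 + y ^ 2 + (c * |y| + c ^ 2 * y ^ 2 / 2 + 2 / c ^ 2 + 2 / c ^ 2 * (c * |y|)) := by
    rw [mul_pow, sq_abs]
    field_simp
    ring
  have h3 : 0 ≤ c * |y| + c ^ 2 * y ^ 2 / 2 + 2 / c ^ 2 + 2 / c ^ 2 * (c * |y|) := by positivity
  have h4 : (1 + 2 / c ^ 2) * (1 + c * |y| + (c * |y|) ^ 2 / 2) ≤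
      (1 + 2 / c ^ 2) * Real.exp (c * |y|) := mul_le_mul_of_nonneg_left h1 (by positivity)
  linarith

theorem IsGoodDensity.exists_decay {μ : SignedMeasure (ℝ × ℝ)} {f : ℝ × ℝ → ℝ}
    (hf : IsGoodDensity μ f) :
    ∃ D, 0 ≤ D ∧ ∀ x, |f x| ≤ D * ((1 + x.1 ^ 2)⁻¹ * (1 + x.2 ^ 2)⁻¹) := by
  obtain ⟨C, hC, c, hc, h⟩ := hf.decay
  refine ⟨C * (1 + 2 / c ^ 2) ^ 2, by positivity, fun x => (h x).trans ?_⟩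
  rw [mul_add, Real.exp_add]
  calc _ ≤ C * (((1 + 2 / c ^ 2) * (1 + x.1 ^ 2)⁻¹) * ((1 + 2 / c ^ 2) * (1 + x.2 ^ 2)⁻¹)) :=
        mul_le_mul_of_nonneg_left (mul_le_mul (exp_neg_mul_abs_le hc _) (exp_neg_mul_abs_le hc _)
          (Real.exp_pos _).le (by positivity)) hC.le
    _ = _ := by ring

/-! ### Box integrals: measurability, majorants and small-box asymptotics. -/

/-- The integral of `f` over the box with centre `p.1` and edge lengths `p.2`. -/
def boxIntegral (f : ℝ × ℝ → ℝ) (p : (ℝ × ℝ) × (ℝ × ℝ)) : ℝ := ∫ y in box p.1 p.2, f y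

theorem measurableSet_box (x u : ℝ × ℝ) : MeasurableSet (box x u) :=
  measurableSet_Icc.prod measurableSet_Icc

theorem IsGoodDensity.apply_box {μ : SignedMeasure (ℝ × ℝ)} {f : ℝ × ℝ → ℝ}
    (hf : IsGoodDensity μ f) (p : (ℝ × ℝ) × (ℝ × ℝ)) : μ (box p.1 p.2) = boxIntegral f p := by
  rw [hf.eq_withDensity, withDensityᵥ_apply hf.integrable (measurableSet_box _ _), boxIntegral]

theorem measurable_boxIntegral {f : ℝ × ℝ → ℝ} (hf : Continuous f) :
    Measurable (boxIntegral f) := by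
  have hS : MeasurableSet {q : ((ℝ × ℝ) × (ℝ × ℝ)) × (ℝ × ℝ) | q.2 ∈ box q.1.1 q.1.2} := by
    refine IsClosed.measurableSet ?_
    simp only [box, Set.mem_prod, Set.mem_Icc, Set.ofPred_and]
    refine IsClosed.inter (IsClosed.inter ?_ ?_) (IsClosed.inter ?_ ?_) <;>
      exact isClosed_le (by fun_prop) (by fun_prop)
  have h := StronglyMeasurable.integral_prod_right' (ν := (volume : Measure (ℝ × ℝ)))
    ((hf.comp continuous_snd).stronglyMeasurable.indicator hS)
  convert h.measurable using 1
  ext p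
  rw [boxIntegral, ← integral_indicator (measurableSet_box _ _)]
  rfl

theorem abs_boxIntegral_le {f : ℝ × ℝ → ℝ} {D : ℝ}
    (hD : ∀ x, |f x| ≤ D * ((1 + x.1 ^ 2)⁻¹ * (1 + x.2 ^ 2)⁻¹)) (p : (ℝ × ℝ) × (ℝ × ℝ)) :
    |boxIntegral f p| ≤ D * (windowMass p.1.1 p.2.1 * windowMass p.1.2 p.2.2) := by
  have hi : Integrable fun x : ℝ × ℝ => D * ((1 + x.1 ^ 2)⁻¹ * (1 + x.2 ^ 2)⁻¹) :=
    (integrable_inv_one_add_sq.mul_prod integrable_inv_one_add_sq).const_mul D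
  calc |boxIntegral f p| ≤ ∫ y in box p.1 p.2, D * ((1 + y.1 ^ 2)⁻¹ * (1 + y.2 ^ 2)⁻¹) :=
        norm_integral_le_of_norm_le (f := f) hi.integrableOn (ae_of_all _ hD)
    _ = _ := by
        rw [integral_const_mul, box, Measure.volume_eq_prod,
          setIntegral_prod_mul (fun a : ℝ => (1 + a ^ 2)⁻¹) (fun a : ℝ => (1 + a ^ 2)⁻¹)]
        rfl

theorem abs_boxIntegral_le_of_nonneg {f : ℝ × ℝ → ℝ} {D : ℝ} (hD0 : 0 ≤ D)
    (hD : ∀ x, |f x| ≤ D * ((1 + x.1 ^ 2)⁻¹ * (1 + x.2 ^ 2)⁻¹)) {p : (ℝ × ℝ) × (ℝ × ℝ)}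
    (h1 : 0 ≤ p.2.1) (h2 : 0 ≤ p.2.2) :
    |boxIntegral f p| ≤ (16 * D) * (((1 + p.1.1 ^ 2)⁻¹ * (1 + p.1.2 ^ 2)⁻¹) *
      ((p.2.1 + p.2.1 ^ 2) * (p.2.2 + p.2.2 ^ 2))) := by
  refine (abs_boxIntegral_le hD p).trans ?_
  calc _ ≤ D * ((4 * (p.2.1 + p.2.1 ^ 2) * (1 + p.1.1 ^ 2)⁻¹) *
        (4 * (p.2.2 + p.2.2 ^ 2) * (1 + p.1.2 ^ 2)⁻¹)) :=
        mul_le_mul_of_nonneg_left (mul_le_mul (windowMass_le _ h1) (windowMass_le _ h2)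
          (windowMass_nonneg _ _) (by positivity)) hD0
    _ = _ := by ring

theorem boxIntegral_sq_le_of_nonneg {f : ℝ × ℝ → ℝ} {D : ℝ}
    (hD : ∀ x, |f x| ≤ D * ((1 + x.1 ^ 2)⁻¹ * (1 + x.2 ^ 2)⁻¹)) {p : (ℝ × ℝ) × (ℝ × ℝ)}
    (h1 : 0 ≤ p.2.1) (h2 : 0 ≤ p.2.2) :
    boxIntegral f p ^ 2 ≤ (17 * D) ^ 2 * (((1 + p.1.1 ^ 2)⁻¹ * (1 + p.1.2 ^ 2)⁻¹) *
      (p.2.1 ^ 2 * p.2.2 ^ 2)) := by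
  have h := pow_le_pow_left₀ (abs_nonneg _) (abs_boxIntegral_le hD p) 2
  rw [sq_abs] at h
  refine h.trans ?_
  calc _ = D ^ 2 * (windowMass p.1.1 p.2.1 ^ 2 * windowMass p.1.2 p.2.2 ^ 2) := by ring
    _ ≤ D ^ 2 * ((17 * p.2.1 ^ 2 * (1 + p.1.1 ^ 2)⁻¹) * (17 * p.2.2 ^ 2 * (1 + p.1.2 ^ 2)⁻¹)) :=
        mul_le_mul_of_nonneg_left (mul_le_mul (windowMass_sq_le _ h1) (windowMass_sq_le _ h2)
          (sq_nonneg _) (by positivity)) (sq_nonneg _)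
    _ = _ := by ring

theorem volume_real_box (x : ℝ × ℝ) {u : ℝ × ℝ} (h1 : 0 ≤ u.1) (h2 : 0 ≤ u.2) :
    volume.real (box x u) = u.1 * u.2 := by
  rw [box, Measure.volume_eq_prod, measureReal_prod_prod, Real.volume_real_Icc_of_le (by linarith),
    Real.volume_real_Icc_of_le (by linarith)]
  ring

/-- The mean of a continuous function over a shrinking box tends to its value at the centre. -/
theorem tendsto_boxIntegral_div_sq {ι : Type*} {l : Filter ι} {ρ : ι → ℝ} (hρ : ∀ i, 0 < ρ i)
    (hρ0 : Tendsto ρ l (𝓝 0)) {f : ℝ × ℝ → ℝ} (hf : Continuous f) (hfi : Integrable f)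
    (x : ℝ × ℝ) {u : ℝ × ℝ} (h1 : 0 < u.1) (h2 : 0 < u.2) :
    Tendsto (fun i => boxIntegral f (x, ρ i • u) / ρ i ^ 2) l (𝓝 (f x * (u.1 * u.2))) := by
  rw [Metric.tendsto_nhds]
  intro ε hε
  have hU : 0 < u.1 * u.2 := mul_pos h1 h2
  -- Half of `ε / (u₁ u₂)`: the integral estimate is non-strict, while the goal is strict.
  obtain ⟨δ, hδ, hfδ⟩ := Metric.continuousAt_iff.1 (hf.continuousAt (x := x))
    (ε / (2 * (u.1 * u.2))) (by positivity)
  have hsmall : ∀ᶠ i in l, ρ i * (u.1 + u.2) < δ := by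
    have : Tendsto (fun i => ρ i * (u.1 + u.2)) l (𝓝 0) := by
      simpa using hρ0.mul_const (u.1 + u.2)
    exact this.eventually_lt_const hδ
  filter_upwards [hsmall] with i hi
  have hr := hρ i
  have hv : volume.real (box x (ρ i • u)) = ρ i ^ 2 * (u.1 * u.2) := by
    rw [volume_real_box x (by simpa using (mul_pos hr h1).le) (by simpa using (mul_pos hr h2).le)]
    simp only [Prod.smul_fst, Prod.smul_snd, smul_eq_mul]
    ring
  have hfin : volume (box x (ρ i • u)) < ∞ := by
    rw [box, Measure.volume_eq_prod, Measure.prod_prod]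
    exact ENNReal.mul_lt_top (by simp) (by simp)
  have hb : ‖∫ y in box x (ρ i • u), (f y - f x)‖ ≤
      ε / (2 * (u.1 * u.2)) * volume.real (box x (ρ i • u)) := by
    refine norm_setIntegral_le_of_norm_le_const hfin fun y hy => ?_
    rw [← dist_eq_norm]
    refine (hfδ ?_).le
    obtain ⟨⟨ha, hb⟩, hc, hd⟩ := hy
    simp only [Prod.smul_fst, Prod.smul_snd, smul_eq_mul] at ha hb hc hd
    have p1 := mul_pos hr h1
    have p2 := mul_pos hr h2
    rw [Prod.dist_eq, max_lt_iff, Real.dist_eq, Real.dist_eq, abs_lt, abs_lt]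
    rw [mul_add] at hi
    refine ⟨⟨?_, ?_⟩, ?_, ?_⟩ <;> linarith
  rw [integral_sub hfi.integrableOn (integrableOn_const hfin.ne), setIntegral_const, hv,
    smul_eq_mul] at hb
  have hq : boxIntegral f (x, ρ i • u) / ρ i ^ 2 - f x * (u.1 * u.2) =
      ((∫ y in box x (ρ i • u), f y) - ρ i ^ 2 * (u.1 * u.2) * f x) / ρ i ^ 2 := by
    rw [boxIntegral]
    field_simp
  rw [Real.dist_eq, hq, abs_div, abs_of_pos (pow_pos hr 2), div_lt_iff₀ (pow_pos hr 2)]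
  refine lt_of_le_of_lt hb ?_
  have : ε / (2 * (u.1 * u.2)) * (ρ i ^ 2 * (u.1 * u.2)) = ε / 2 * ρ i ^ 2 := by field_simp
  rw [this]
  exact mul_lt_mul_of_pos_right (by linarith) (pow_pos hr 2)

/-! ### Second-order expansion of the exponential. -/

theorem norm_cexp_sub_one_sub_le (t : ℝ) :
    ‖Complex.exp (t * Complex.I) - 1 - t * Complex.I‖ ≤ 2 * t ^ 2 := by
  have hn : ‖(t : ℂ) * Complex.I‖ = |t| := by simp
  rcases le_or_gt |t| 1 with h | h
  · refine (Complex.norm_exp_sub_one_sub_id_le (by rwa [hn])).trans ?_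
    rw [hn, sq_abs]
    nlinarith [sq_nonneg t]
  · refine (norm_sub_le _ _).trans ?_
    have := norm_cexp_ofReal_mul_I_sub_one_le t
    rw [Real.norm_eq_abs] at this
    rw [hn]
    nlinarith [sq_abs t]

/-- With `t = h / a`, the third-order remainder is at most `a² |t|³ e^{|t|} = h² |t| e^{|t|}`, which
vanishes because `h` converges and `t → 0`. -/
theorem tendsto_sq_mul_cexp_sub {ι : Type*} {l : Filter ι} {a h : ι → ℝ} {H : ℝ}
    (ha : Tendsto a l atTop) (hh : Tendsto h l (𝓝 H)) :
    Tendsto (fun i => (a i : ℂ) ^ 2 * (Complex.exp ((h i / a i : ℝ) * Complex.I) - 1 -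
      (h i / a i : ℝ) * Complex.I)) l (𝓝 (-(H : ℂ) ^ 2 / 2)) := by
  have h0 : Tendsto (fun i => h i / a i) l (𝓝 0) := hh.div_atTop ha
  have hmain : Tendsto (fun i => -(h i : ℂ) ^ 2 / 2) l (𝓝 (-(H : ℂ) ^ 2 / 2)) :=
    (((by fun_prop : Continuous fun x : ℝ => -(x : ℂ) ^ 2 / 2)).tendsto H).comp hh
  have herr : Tendsto (fun i => |h i| ^ 2 * |h i / a i| * Real.exp |h i / a i|) l (𝓝 0) := by
    have := ((hh.abs.pow 2).mul h0.abs).mul ((Real.continuous_exp.tendsto _).comp h0.abs)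
    simpa using this
  refine (hmain.congr_dist ?_)
  refine squeeze_zero' (Eventually.of_forall fun i => dist_nonneg) ?_ herr
  filter_upwards [ha.eventually_gt_atTop 0] with i hi
  have hb := Complex.norm_exp_sub_sum_le_norm_mul_exp ((h i / a i : ℝ) * Complex.I) 3
  set t : ℝ := h i / a i with ht
  have hn : ‖(t : ℂ) * Complex.I‖ = |t| := by simp
  have hha : h i = a i * t := by rw [ht]; field_simp
  rw [hn] at hb
  have he : -(h i : ℂ) ^ 2 / 2 - (a i : ℂ) ^ 2 * (Complex.exp (t * Complex.I) - 1 - t * Complex.I)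
      = -((a i : ℂ) ^ 2 * (Complex.exp (t * Complex.I) -
        ∑ m ∈ Finset.range 3, ((t : ℂ) * Complex.I) ^ m / m.factorial)) := by
    rw [hha]
    simp only [Finset.sum_range_succ, Finset.sum_range_zero, Nat.factorial, mul_pow,
      Complex.I_sq]
    push_cast
    ring
  rw [dist_eq_norm, he, norm_neg, norm_mul, norm_pow, Complex.norm_real, Real.norm_eq_abs, sq_abs]
  calc _ ≤ a i ^ 2 * (|t| ^ 3 * Real.exp |t|) := mul_le_mul_of_nonneg_left hb (sq_nonneg _)
    _ = _ := by
      rw [hha, abs_mul, abs_of_pos hi]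
      ring

/-! ### The edge-length law and the intensity measure. -/

/-- The measure `f(u) du` on the open positive half-line. -/
def edgeMarginal (f : ℝ → ℝ) : Measure ℝ :=
  ((volume : Measure ℝ).restrict (Set.Ioi 0)).withDensity fun u => ENNReal.ofReal (f u)

instance (f : ℝ → ℝ) : SFinite (edgeMarginal f) := by
  rw [edgeMarginal]
  infer_instance

theorem edgeLaw_eq_prod {f₁ f₂ : ℝ → ℝ} (hf₁ : Measurable f₁) (hf₂ : Measurable f₂)
    (h₁ : ∀ u > 0, 0 ≤ f₁ u) : edgeLaw f₁ f₂ = (edgeMarginal f₁).prod (edgeMarginal f₂) := by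
  rw [edgeMarginal, edgeMarginal, prod_withDensity hf₁.ennreal_ofReal hf₂.ennreal_ofReal,
    Measure.prod_restrict, ← Measure.volume_eq_prod, edgeLaw]
  refine withDensity_congr_ae ?_
  filter_upwards [ae_restrict_mem (measurableSet_Ioi.prod measurableSet_Ioi)] with u hu
  exact ENNReal.ofReal_mul (h₁ _ hu.1)

theorem edgeMarginal_ae_pos (f : ℝ → ℝ) : ∀ᵐ u ∂edgeMarginal f, 0 < u :=
  (withDensity_absolutelyContinuous _ _).ae_le (ae_restrict_mem measurableSet_Ioi)

theorem integrable_sq_edgeMarginal {f : ℝ → ℝ} (hf : Measurable f) (h : ∀ u > 0, 0 ≤ f u)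
    (hv : IntegrableOn (fun u => u ^ 2 * f u) (Set.Ioi (0 : ℝ))) :
    Integrable (fun u : ℝ => u ^ 2) (edgeMarginal f) := by
  rw [edgeMarginal, integrable_withDensity_iff_integrable_smul' hf.ennreal_ofReal
    (ae_of_all _ fun _ => ENNReal.ofReal_lt_top)]
  refine Integrable.congr hv ?_
  filter_upwards [ae_restrict_mem measurableSet_Ioi] with u hu
  rw [ENNReal.toReal_ofReal (h u hu), smul_eq_mul, mul_comm]

theorem integral_sq_edgeMarginal {f : ℝ → ℝ} (hf : Measurable f) (h : ∀ u > 0, 0 ≤ f u) :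
    ∫ u, u ^ 2 ∂edgeMarginal f = secondMoment f := by
  rw [edgeMarginal, integral_withDensity_eq_integral_toReal_smul hf.ennreal_ofReal
    (ae_of_all _ fun _ => ENNReal.ofReal_lt_top), secondMoment]
  refine integral_congr_ae ?_
  filter_upwards [ae_restrict_mem measurableSet_Ioi] with u hu
  rw [ENNReal.toReal_ofReal (h u hu), smul_eq_mul, mul_comm]

theorem integral_sq_pos {F : Measure ℝ} (hF : F ≠ 0) (hpos : ∀ᵐ u ∂F, 0 < u)
    (hi : Integrable (fun u => u ^ 2) F) : 0 < ∫ u, u ^ 2 ∂F := by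
  refine lt_of_le_of_ne (integral_nonneg fun u => sq_nonneg u) fun h => hF ?_
  have h0 := (integral_eq_zero_iff_of_nonneg (fun u => sq_nonneg u) hi).1 h.symm
  rw [← ae_eq_bot, ← Filter.eventually_false_iff_eq_bot]
  filter_upwards [h0, hpos] with u h1 h2
  exact (pow_pos h2 2).ne' h1

/-- Only the product `f₁ f₂` is normalised, so the marginals need not be probability measures;
finite and nonzero is what the argument requires. -/
theorem isFiniteMeasure_of_prod {α β : Type*} [MeasurableSpace α] [MeasurableSpace β]
    {μ : Measure α} {ν : Measure β} [SFinite ν] [h : IsProbabilityMeasure (μ.prod ν)] :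
    IsFiniteMeasure μ ∧ IsFiniteMeasure ν ∧ μ ≠ 0 ∧ ν ≠ 0 := by
  have h1 : μ Set.univ * ν Set.univ = 1 := by
    rw [← Measure.prod_prod, Set.univ_prod_univ, h.measure_univ]
  have hμ : μ Set.univ ≠ 0 := fun h0 => by simp [h0] at h1
  have hν : ν Set.univ ≠ 0 := fun h0 => by simp [h0] at h1
  refine ⟨⟨lt_top_iff_ne_top.2 fun h0 => ?_⟩, ⟨lt_top_iff_ne_top.2 fun h0 => ?_⟩,
    fun h0 => hμ (by simp [h0]), fun h0 => hν (by simp [h0])⟩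
  · rw [h0, ENNReal.top_mul hν] at h1
    exact ENNReal.top_ne_one h1
  · rw [h0, ENNReal.mul_top hμ] at h1
    exact ENNReal.top_ne_one h1

theorem intensity_eq (F : Measure (ℝ × ℝ)) [SFinite F] (lam ρ : ℝ) :
    intensity F lam ρ = ENNReal.ofReal lam •
      ((volume : Measure (ℝ × ℝ)).prod F).map (Prod.map id fun u => ρ • u) := by
  rw [intensity, ← Measure.map_prod_map _ _ measurable_id (by fun_prop), Measure.map_id]

/-- Moves `λ` and `ρ` from the measure into the integrand, so that dominated convergence applies
over a fixed measure. -/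
theorem integral_intensity {F : Measure (ℝ × ℝ)} [SFinite F] {lam ρ : ℝ} (hlam : 0 ≤ lam)
    {G : (ℝ × ℝ) × (ℝ × ℝ) → ℂ} (hG : Measurable G) :
    ∫ p, G p ∂intensity F lam ρ =
      ∫ p : (ℝ × ℝ) × (ℝ × ℝ), (lam : ℂ) * G (p.1, ρ • p.2) ∂(volume.prod F) := by
  rw [intensity_eq, integral_smul_measure, integral_map (by fun_prop) hG.aestronglyMeasurable,
    ENNReal.toReal_ofReal hlam, integral_const_mul, Complex.real_smul]
  rfl

/-! ### Convergence of the exponent. -/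

section Exponent

variable {F₁ F₂ : Measure ℝ}

theorem ae_pos_prod (hp₁ : ∀ᵐ u ∂F₁, 0 < u) (hp₂ : ∀ᵐ u ∂F₂, 0 < u) :
    ∀ᵐ p : (ℝ × ℝ) × (ℝ × ℝ) ∂(volume.prod (F₁.prod F₂)), 0 < p.2.1 ∧ 0 < p.2.2 :=
  Measure.quasiMeasurePreserving_snd.ae
    ((Measure.quasiMeasurePreserving_fst.ae hp₁).and (Measure.quasiMeasurePreserving_snd.ae hp₂))

theorem integrable_prod_weight {m₁ m₂ : ℝ → ℝ} (h₁ : Integrable m₁ F₁) (h₂ : Integrable m₂ F₂) :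
    Integrable (fun p : (ℝ × ℝ) × (ℝ × ℝ) => ((1 + p.1.1 ^ 2)⁻¹ * (1 + p.1.2 ^ 2)⁻¹) *
      (m₁ p.2.1 * m₂ p.2.2)) (volume.prod (F₁.prod F₂)) :=
  Integrable.mul_prod (f := fun x : ℝ × ℝ => (1 + x.1 ^ 2)⁻¹ * (1 + x.2 ^ 2)⁻¹)
    (g := fun u : ℝ × ℝ => m₁ u.1 * m₂ u.2)
    (integrable_inv_one_add_sq.mul_prod integrable_inv_one_add_sq) (h₁.mul_prod h₂)

variable [IsFiniteMeasure F₁] [IsFiniteMeasure F₂]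

theorem integrable_add_sq {F : Measure ℝ} [IsFiniteMeasure F]
    (hi : Integrable (fun u => u ^ 2) F) (ρ : ℝ) :
    Integrable (fun u => ρ * u + (ρ * u) ^ 2) F := by
  have h1 : Integrable (fun u : ℝ => u) F := by
    refine ((integrable_const (1 : ℝ)).add hi).mono' (by fun_prop) (ae_of_all _ fun u => ?_)
    change |u| ≤ 1 + u ^ 2
    nlinarith [sq_abs u, sq_nonneg (|u| - 1), abs_nonneg u]
  simp_rw [mul_pow]
  exact (h1.const_mul ρ).add (hi.const_mul _)

theorem integrable_boxIntegral_intensity {f : ℝ × ℝ → ℝ} (hf : Continuous f) {D : ℝ} (hD0 : 0 ≤ D)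
    (hD : ∀ x, |f x| ≤ D * ((1 + x.1 ^ 2)⁻¹ * (1 + x.2 ^ 2)⁻¹))
    (hp₁ : ∀ᵐ u ∂F₁, 0 < u) (hp₂ : ∀ᵐ u ∂F₂, 0 < u)
    (hi₁ : Integrable (fun u => u ^ 2) F₁) (hi₂ : Integrable (fun u => u ^ 2) F₂)
    (lam : ℝ) {ρ : ℝ} (hρ : 0 < ρ) :
    Integrable (boxIntegral f) (intensity (F₁.prod F₂) lam ρ) := by
  rw [intensity_eq]
  refine Integrable.smul_measure ?_ ENNReal.ofReal_ne_top
  rw [integrable_map_measure (measurable_boxIntegral hf).aestronglyMeasurable (by fun_prop)]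
  refine ((integrable_prod_weight (integrable_add_sq hi₁ ρ) (integrable_add_sq hi₂ ρ)).const_mul
    (16 * D)).mono' ((measurable_boxIntegral hf).comp (by fun_prop)).aestronglyMeasurable ?_
  filter_upwards [ae_pos_prod hp₁ hp₂] with p hp
  exact abs_boxIntegral_le_of_nonneg hD0 hD (p := (p.1, ρ • p.2)) (mul_pos hρ hp.1).le
    (mul_pos hρ hp.2).le

/-- The logarithm of the characteristic function of the normalised centred integral converges to
that of a centred Gaussian variable. -/
theorem tendsto_exponent {ι : Type*} {l : Filter ι} [l.IsCountablyGenerated] {ρ lam : ι → ℝ}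
    (hρ : ∀ i, 0 < ρ i) (hρ0 : Tendsto ρ l (𝓝 0)) (hlam : ∀ i, 0 < lam i)
    (hlamt : Tendsto lam l atTop) {f : ℝ × ℝ → ℝ} (hf : Continuous f) (hfi : Integrable f) {D : ℝ}
    (hD : ∀ x, |f x| ≤ D * ((1 + x.1 ^ 2)⁻¹ * (1 + x.2 ^ 2)⁻¹))
    (hp₁ : ∀ᵐ u ∂F₁, 0 < u) (hp₂ : ∀ᵐ u ∂F₂, 0 < u)
    (hi₁ : Integrable (fun u => u ^ 2) F₁) (hi₂ : Integrable (fun u => u ^ 2) F₂)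
    {v₁ v₂ : ℝ} (hv₁ : ∫ u, u ^ 2 ∂F₁ = v₁) (hv₂ : ∫ u, u ^ 2 ∂F₂ = v₂)
    (hv₁0 : 0 < v₁) (hv₂0 : 0 < v₂) :
    Tendsto (fun i => ∫ p,
      (Complex.exp ((boxIntegral f p / (ρ i ^ 2 * √(lam i * v₁ * v₂)) : ℝ) * Complex.I) - 1 -
        (boxIntegral f p / (ρ i ^ 2 * √(lam i * v₁ * v₂)) : ℝ) * Complex.I)
        ∂intensity (F₁.prod F₂) (lam i) (ρ i)) l
      (𝓝 (-((∫ x, f x * f x : ℝ) : ℂ) / 2)) := by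
  have hm := measurable_boxIntegral hf
  have hV : 0 < v₁ * v₂ := mul_pos hv₁0 hv₂0
  set a : ι → ℝ := fun i => √(lam i * v₁ * v₂) with ha
  -- Thus `λ = a² / (v₁ v₂)`, which brings the integrand to the form of `tendsto_sq_mul_cexp_sub`.
  have haa : ∀ i, a i ^ 2 = lam i * (v₁ * v₂) := fun i => by
    rw [ha, Real.sq_sqrt (by have := hlam i; positivity), mul_assoc]
  have hapos : ∀ i, 0 < a i := fun i => Real.sqrt_pos.2 (by have := hlam i; positivity)
  have hat : Tendsto a l atTop :=
    Real.tendsto_sqrt_atTop.comp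
      ((hlamt.atTop_mul_const hv₁0).atTop_mul_const hv₂0)
  have hlim : ∫ p : (ℝ × ℝ) × (ℝ × ℝ), ((v₁ * v₂ : ℝ) : ℂ)⁻¹ *
      (-((f p.1 * (p.2.1 * p.2.2) : ℝ) : ℂ) ^ 2 / 2) ∂(volume.prod (F₁.prod F₂)) =
      -((∫ x, f x * f x : ℝ) : ℂ) / 2 := by
    have h1 : ∀ p : (ℝ × ℝ) × (ℝ × ℝ), ((v₁ * v₂ : ℝ) : ℂ)⁻¹ *
        (-((f p.1 * (p.2.1 * p.2.2) : ℝ) : ℂ) ^ 2 / 2) =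
        ((-(v₁ * v₂)⁻¹ / 2 * ((f p.1 * f p.1) * (p.2.1 ^ 2 * p.2.2 ^ 2)) : ℝ) : ℂ) := fun p => by
      push_cast
      ring
    simp_rw [h1]
    rw [integral_complex_ofReal, integral_const_mul,
      integral_prod_mul (fun x => f x * f x) (fun u : ℝ × ℝ => u.1 ^ 2 * u.2 ^ 2),
      integral_prod_mul (fun u : ℝ => u ^ 2) (fun u : ℝ => u ^ 2), hv₁, hv₂]
    push_cast
    have : (v₁ : ℂ) ≠ 0 := by exact_mod_cast hv₁0.ne'
    have : (v₂ : ℂ) ≠ 0 := by exact_mod_cast hv₂0.ne'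
    field_simp
  rw [← hlim]
  have hG : ∀ i, Measurable fun p =>
      Complex.exp ((boxIntegral f p / (ρ i ^ 2 * a i) : ℝ) * Complex.I) - 1 -
        (boxIntegral f p / (ρ i ^ 2 * a i) : ℝ) * Complex.I := fun i => by fun_prop
  refine Tendsto.congr (fun i =>
    (integral_intensity (F := F₁.prod F₂) (ρ := ρ i) (hlam i).le (hG i)).symm) ?_
  refine tendsto_integral_filter_of_dominated_convergence
    (fun p => 2 * (v₁ * v₂)⁻¹ * ((17 * D) ^ 2 * (((1 + p.1.1 ^ 2)⁻¹ * (1 + p.1.2 ^ 2)⁻¹) *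
      (p.2.1 ^ 2 * p.2.2 ^ 2))))
    (Eventually.of_forall fun i =>
      (((hG i).comp (by fun_prop : Measurable fun p : (ℝ × ℝ) × (ℝ × ℝ) =>
        (p.1, ρ i • p.2))).const_mul _).aestronglyMeasurable)
    (Eventually.of_forall fun i => ?_)
    (((integrable_prod_weight hi₁ hi₂).const_mul _).const_mul _) ?_
  · filter_upwards [ae_pos_prod hp₁ hp₂] with p hp
    have hr := hρ i
    rw [norm_mul, Complex.norm_real, Real.norm_of_nonneg (hlam i).le]
    have h2 := boxIntegral_sq_le_of_nonneg hD (p := (p.1, ρ i • p.2)) (mul_pos hr hp.1).le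
      (mul_pos hr hp.2).le
    refine (mul_le_mul_of_nonneg_left (norm_cexp_sub_one_sub_le _) (hlam i).le).trans ?_
    -- `λ` cancels against `a²`; the remaining `ρ⁴` cancels against the squared edge lengths in
    -- `h2`.
    have h3 : lam i * (2 * (boxIntegral f (p.1, ρ i • p.2) / (ρ i ^ 2 * a i)) ^ 2) =
        2 * (v₁ * v₂)⁻¹ * (boxIntegral f (p.1, ρ i • p.2) ^ 2 / ρ i ^ 4) := by
      rw [div_pow, mul_pow, haa]
      have := (hlam i).ne'
      field_simp
    rw [h3]
    refine mul_le_mul_of_nonneg_left ?_ (by positivity)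
    rw [div_le_iff₀ (by positivity)]
    refine h2.trans (le_of_eq ?_)
    simp only [Prod.smul_fst, Prod.smul_snd, smul_eq_mul]
    ring
  · filter_upwards [ae_pos_prod hp₁ hp₂] with p hp
    have h := (tendsto_sq_mul_cexp_sub hat
      (tendsto_boxIntegral_div_sq hρ hρ0 hf hfi p.1 hp.1 hp.2)).const_mul ((v₁ * v₂ : ℝ) : ℂ)⁻¹
    refine h.congr fun i => ?_
    rw [← mul_assoc, ← Complex.ofReal_pow, haa, div_div]
    congr 1
    have : ((v₁ * v₂ : ℝ) : ℂ) ≠ 0 := by exact_mod_cast hV.ne'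
    rw [Complex.ofReal_mul (lam i)]
    field_simp

end Exponent

/-! ### The isonormal process over a Hilbert space. -/

section Isonormal

theorem coeFn_Lp_sum {α ι : Type*} [MeasurableSpace α] {μ : Measure α} {p : ℝ≥0∞}
    (s : Finset ι) (Y : ι → Lp ℝ p μ) :
    (∑ i ∈ s, Y i : Lp ℝ p μ) =ᵐ[μ] fun x => ∑ i ∈ s, Y i x := by
  classical
  induction s using Finset.induction_on with
  | empty => exact Lp.coeFn_zero ℝ p μ
  | insert i s hi ih =>
    rw [Finset.sum_insert hi]
    filter_upwards [Lp.coeFn_add (Y i) (∑ j ∈ s, Y j), ih] with x h1 h2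
    rw [h1, Pi.add_apply, h2, Finset.sum_insert hi]

theorem enorm_cexp_sub_cexp_le (x y : ℝ) :
    ‖Complex.exp (x * Complex.I) - Complex.exp (y * Complex.I)‖ₑ ≤ ‖x - y‖ₑ := by
  rw [enorm_le_iff_norm_le]
  have h : Complex.exp (x * Complex.I) - Complex.exp (y * Complex.I) =
      Complex.exp (y * Complex.I) * (Complex.exp ((x - y : ℝ) * Complex.I) - 1) := by
    rw [mul_sub, ← Complex.exp_add, mul_one]
    push_cast
    ring_nf
  rw [h, norm_mul, Complex.norm_exp_ofReal_mul_I, one_mul]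
  exact norm_cexp_ofReal_mul_I_sub_one_le _

variable {Ω : Type*} [MeasurableSpace Ω] {P : Measure Ω} [IsProbabilityMeasure P]

/-- The map is 1-Lipschitz: `x ↦ e^{ix}` is, and the `L¹` norm is at most the `L²` norm under a
probability measure. -/
theorem continuous_integral_cexp_Lp :
    Continuous fun Y : Lp ℝ 2 P => ∫ ω, Complex.exp ((Y ω : ℝ) * Complex.I) ∂P := by
  have hi : ∀ Y : Lp ℝ 2 P, Integrable (fun ω => Complex.exp ((Y ω : ℝ) * Complex.I)) P :=
    fun Y => (integrable_const (1 : ℝ)).mono' (by have := (Lp.memLp Y).1; fun_prop)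
      (ae_of_all _ fun ω => (Complex.norm_exp_ofReal_mul_I _).le)
  refine LipschitzWith.continuous (K := 1) fun Y Z => ?_
  rw [edist_eq_enorm_sub, ← integral_sub (hi Y) (hi Z), ENNReal.coe_one, one_mul, Lp.edist_def]
  calc _ ≤ ∫⁻ ω, ‖Y ω - Z ω‖ₑ ∂P := (enorm_integral_le_lintegral_enorm _).trans
        (lintegral_mono fun ω => enorm_cexp_sub_cexp_le _ _)
    _ = eLpNorm (⇑Y - ⇑Z) 1 P := eLpNorm_one_eq_lintegral_enorm.symm
    _ ≤ _ := eLpNorm_le_eLpNorm_of_exponent_le (by norm_num)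
        ((Lp.memLp Y).1.sub (Lp.memLp Z).1)

theorem map_eq_gaussianReal_of_forall_cexp {Y : Ω → ℝ} (hY : AEMeasurable Y P) (v : NNReal)
    (h : ∀ t : ℝ, ∫ ω, Complex.exp ((t * Y ω : ℝ) * Complex.I) ∂P =
      Complex.exp (-((t ^ 2 * v : ℝ) : ℂ) / 2)) : P.map Y = gaussianReal 0 v := by
  have := Measure.isProbabilityMeasure_map hY
  refine Measure.ext_of_charFun (funext fun t => ?_)
  rw [charFun_gaussianReal, charFun_apply, integral_map hY (by fun_prop)]
  simp only [Real.inner_apply]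
  rw [← funext fun ω => congrArg (fun x : ℝ => Complex.exp (x * Complex.I)) (mul_comm t (Y ω)), h]
  congr 1
  push_cast
  ring

/-- An isometry of a Hilbert space into the square-integrable functions on some probability space
all of whose values are centred Gaussian variables. -/
theorem exists_isonormal (H : Type) [NormedAddCommGroup H] [InnerProductSpace ℝ H]
    [CompleteSpace H] :
    ∃ (Ω : Type) (_ : MeasurableSpace Ω) (P : Measure Ω) (W : H →ₗᵢ[ℝ] Lp ℝ 2 P),
      IsProbabilityMeasure P ∧ ∀ h, P.map (W h) = gaussianReal 0 (‖h‖₊ ^ 2) := by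
  obtain ⟨w, b, -⟩ := exists_hilbertBasis ℝ H
  set P : Measure (w → ℝ) := Measure.infinitePi fun _ => gaussianReal 0 1 with hP
  have hmap : ∀ i, P.map (fun ω => ω i) = gaussianReal 0 1 := fun i =>
    Measure.infinitePi_map_eval _ i
  have hev : ∀ i : w, Measurable fun ω : w → ℝ => ω i := measurable_pi_apply
  have hind : iIndepFun (fun (i : w) ω => ω i) P :=
    iIndepFun_infinitePi (X := fun _ x => x) fun _ => measurable_id
  have hg : ∀ i, HasGaussianLaw (fun ω : w → ℝ => ω i) P := fun i =>
    ⟨by rw [hmap]; infer_instance⟩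
  have hmean : ∀ i, ∫ ω, ω i ∂P = 0 := fun i => by
    have := integral_map (μ := P) (φ := fun ω => ω i) (f := fun x : ℝ => x) (hev i).aemeasurable
      (by fun_prop)
    rw [hmap, integral_id_gaussianReal] at this
    exact this.symm
  have hvar : ∀ i, ∫ ω, ω i * ω i ∂P = 1 := fun i => by
    have h1 := variance_map (μ := P) (X := fun x : ℝ => x) (Y := fun ω => ω i) (by fun_prop)
      (hev i).aemeasurable
    have h2 : Var[fun x : ℝ => x; gaussianReal 0 1] = 1 := by simp
    rw [hmap, h2, Function.comp_def,
      variance_of_integral_eq_zero (hev i).aemeasurable (hmean i)] at h1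
    simpa [sq] using h1.symm
  set e : w → Lp ℝ 2 P := fun i => (hg i).memLp_two.toLp _ with he
  have hee : ∀ i, e i =ᵐ[P] fun ω => ω i := fun i => MemLp.coeFn_toLp _
  have hon : Orthonormal ℝ e := by
    classical
    rw [orthonormal_iff_ite]
    intro i j
    rw [L2.inner_def]
    have h1 : ∫ ω, inner ℝ (e i ω) (e j ω) ∂P = ∫ ω, ω i * ω j ∂P := by
      refine integral_congr_ae ?_
      filter_upwards [hee i, hee j] with ω h1 h2
      rw [h1, h2, Real.inner_apply]
    rw [h1]
    split_ifs with hij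
    · rw [hij, hvar]
    · have := (hind.indepFun hij).integral_fun_mul_eq_mul_integral
        (hev i).aestronglyMeasurable (hev j).aestronglyMeasurable
      rw [this, hmean, zero_mul]
  -- Independent standard Gaussian coordinates are orthonormal in `L²(P)`, so sending the Hilbert
  -- basis to them extends to an isometry.
  set V : lp (fun _ : w => ℝ) 2 →ₗᵢ[ℝ] Lp ℝ 2 P := hon.orthogonalFamily.linearIsometry with hV
  set W : H →ₗᵢ[ℝ] Lp ℝ 2 P := V.comp b.repr.toLinearIsometry with hW
  have hfin : ∀ (c : w → ℝ) (s : Finset w),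
      ∫ ω, Complex.exp (((∑ i ∈ s, c i • e i : Lp ℝ 2 P) ω : ℝ) * Complex.I) ∂P =
        Complex.exp (-((‖(∑ i ∈ s, c i • e i : Lp ℝ 2 P)‖ ^ 2 : ℝ) : ℂ) / 2) := by
    intro c s
    have hevc : ∀ i : w, Measurable fun ω : w → ℝ => ω i * c i := fun i => (hev i).mul_const _
    have hae : (∑ i ∈ s, c i • e i : Lp ℝ 2 P) =ᵐ[P] fun ω => ∑ i ∈ s, ω i * c i := by
      have h1 : ∀ᵐ ω ∂P, ∀ i ∈ s, (c i • e i : Lp ℝ 2 P) ω = ω i * c i := by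
        rw [Finset.eventually_all]
        intro i _
        filter_upwards [Lp.coeFn_smul (c i) (e i), hee i] with ω h1 h2
        rw [h1, Pi.smul_apply, h2, smul_eq_mul, mul_comm]
      filter_upwards [coeFn_Lp_sum s (fun i => c i • e i), h1] with ω h2 h3
      rw [h2]
      exact Finset.sum_congr rfl h3
    have hcf : charFun (P.map fun ω => ∑ i ∈ s, ω i * c i) 1 =
        ∏ i ∈ s, charFun (P.map fun ω => ω i * c i) 1 := by
      have hind2 : iIndepFun (fun (i : w) ω => ω i * c i) P :=
        hind.comp (fun i x => x * c i) fun i => by fun_prop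
      have hind3 := hind2.precomp (g := fun i : s => (i : w)) Subtype.val_injective
      rw [iIndepFun.charFun_map_fun_finsetSum_eq_prod (P := P)
        (X := fun (i : w) (ω : w → ℝ) => ω i * c i) (fun i _ => (hevc i).aemeasurable) hind3, Finset.prod_apply]
    have hone : ∀ i, charFun (P.map fun ω => ω i * c i) 1 =
        Complex.exp (-((c i * c i : ℝ) : ℂ) / 2) := by
      intro i
      have h1 := charFun_gaussianReal (μ := 0) (v := 1) (c i)
      rw [← hmap i, charFun_apply, integral_map (hev i).aemeasurable (by fun_prop)] at h1
      rw [charFun_apply, integral_map (hevc i).aemeasurable (by fun_prop)]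
      simp only [Real.inner_apply, mul_one] at h1 ⊢
      rw [h1]
      congr 1
      push_cast
      ring
    calc _ = ∫ ω, Complex.exp ((∑ i ∈ s, ω i * c i : ℝ) * Complex.I) ∂P :=
          integral_congr_ae (by filter_upwards [hae] with ω h; rw [h])
      _ = charFun (P.map fun ω => ∑ i ∈ s, ω i * c i) 1 := by
          rw [charFun_apply, integral_map
            (Finset.measurable_fun_sum s fun i _ => hevc i).aemeasurable (by fun_prop)]
          simp
      _ = _ := by
          rw [hcf, Finset.prod_congr rfl fun i _ => hone i, ← Complex.exp_sum,
            ← real_inner_self_eq_norm_sq, hon.inner_sum]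
          congr 1
          push_cast
          rw [← Finset.sum_div, Finset.sum_neg_distrib]
          simp
  have hchar : ∀ h, ∫ ω, Complex.exp ((W h ω : ℝ) * Complex.I) ∂P =
      Complex.exp (-((‖h‖ ^ 2 : ℝ) : ℂ) / 2) := by
    intro h
    -- The Gaussian identity is a closed condition in `L²`, so it passes from the finite sums of
    -- `hfin` to their limit `W h`.
    have hclosed : IsClosed {Y : Lp ℝ 2 P | ∫ ω, Complex.exp ((Y ω : ℝ) * Complex.I) ∂P =
        Complex.exp (-((‖Y‖ ^ 2 : ℝ) : ℂ) / 2)} :=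
      isClosed_eq continuous_integral_cexp_Lp (by fun_prop)
    have hs : HasSum (fun i => b.repr h i • e i) (W h) :=
      hon.orthogonalFamily.hasSum_linearIsometry (b.repr h)
    have := hclosed.mem_of_tendsto hs (Eventually.of_forall fun s => hfin _ s)
    rw [Set.mem_ofPred_eq, W.norm_map] at this
    exact this
  refine ⟨w → ℝ, inferInstance, P, W, inferInstance, fun h => ?_⟩
  refine map_eq_gaussianReal_of_forall_cexp (Lp.memLp (W h)).1.aemeasurable _ fun t => ?_
  have h1 := hchar (t • h)
  rw [norm_smul, mul_pow, Real.norm_eq_abs, sq_abs] at h1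
  rw [NNReal.coe_pow, coe_nnnorm, ← h1, map_smul]
  refine integral_congr_ae ?_
  filter_upwards [Lp.coeFn_smul t (W h)] with ω h2
  rw [h2, Pi.smul_apply, smul_eq_mul]

end Isonormal

/-! ### Densities in `L²` and the limit field. -/

section Density

theorem integrable_density_mul (μ ν : MP) :
    Integrable fun x => density μ x * density ν x := by
  obtain ⟨D, hD0, hD⟩ := (density_spec μ).exists_decay
  refine (density_spec ν).integrable.bdd_mul
    (density_spec μ).continuous.aestronglyMeasurable (c := D) (ae_of_all _ fun x => ?_)
  refine (hD x).trans (mul_le_of_le_one_right hD0 ?_)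
  have h : ∀ y : ℝ, (1 + y ^ 2)⁻¹ ≤ 1 := fun y =>
    inv_le_one_of_one_le₀ (by nlinarith [sq_nonneg y])
  exact mul_le_one₀ (h _) (by positivity) (h _)

theorem memLp_density (μ : MP) : MemLp (density μ) 2 :=
  (memLp_two_iff_integrable_sq (density_spec μ).continuous.aestronglyMeasurable).2
    (by simpa [sq] using integrable_density_mul μ μ)

/-- Densities are picked by choice, so linearity comes from almost everywhere uniqueness of the
density of a signed measure. -/
theorem density_linear (a b : ℝ) (μ ν : MP) :
    density (a • μ + b • ν) =ᵐ[volume] a • density μ + b • density ν := by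
  have hi := ((density_spec μ).integrable.smul a).add ((density_spec ν).integrable.smul b)
  refine (density_spec _).integrable.ae_eq_of_withDensityᵥ_eq hi ?_
  rw [← (density_spec _).eq_withDensity, withDensityᵥ_add ((density_spec μ).integrable.smul a)
    ((density_spec ν).integrable.smul b), withDensityᵥ_smul, withDensityᵥ_smul,
    ← (density_spec _).eq_withDensity, ← (density_spec _).eq_withDensity]
  rfl

end Density

/-- Existence of the centred Gaussian linear field with the `L²` covariance of the densities. -/
theorem exists_gaussian_field :
    ∃ (Ω' : Type) (_ : MeasurableSpace Ω') (P' : Measure Ω') (X : MP → Ω' → ℝ),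
      IsProbabilityMeasure P' ∧
      IsCentredGaussianLinearField X (fun μ ν => ∫ x, density μ x * density ν x) P' := by
  obtain ⟨Ω', m, P', W, hP', hW⟩ := exists_isonormal (Lp ℝ 2 (volume : Measure (ℝ × ℝ)))
  set T : MP → Lp ℝ 2 (volume : Measure (ℝ × ℝ)) := fun μ => (memLp_density μ).toLp _ with hT
  have hTT : ∀ μ, T μ =ᵐ[volume] density μ := fun μ => MemLp.coeFn_toLp _
  have hTlin : ∀ (a b : ℝ) (μ ν : MP), T (a • μ + b • ν) = a • T μ + b • T ν := by
    intro a b μ ν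
    refine Lp.ext ?_
    filter_upwards [hTT (a • μ + b • ν), density_linear a b μ ν, hTT μ, hTT ν,
      Lp.coeFn_add (a • T μ) (b • T ν), Lp.coeFn_smul a (T μ), Lp.coeFn_smul b (T ν)]
      with x h1 h2 h3 h4 h5 h6 h7
    rw [h1, h2, h5]
    simp only [Pi.add_apply, Pi.smul_apply, h6, h7, h3, h4]
  have hmean : ∀ h, ∫ ω, W h ω ∂P' = 0 := fun h => by
    have := integral_map (μ := P') (φ := W h) (f := fun x : ℝ => x)
      (Lp.memLp (W h)).1.aemeasurable (by fun_prop)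
    rw [hW, integral_id_gaussianReal] at this
    exact this.symm
  refine ⟨Ω', m, P', fun μ => W (T μ), hP', ⟨⟨fun I => ⟨?_⟩⟩, fun μ => hmean _, fun μ ν => ?_,
    fun a b μ ν => ?_⟩⟩
  · have hm : AEMeasurable (fun ω => I.restrict fun μ => W (T μ) ω) P' :=
      aemeasurable_pi_lambda _ fun i => (Lp.memLp _).1.aemeasurable
    refine isGaussian_of_isGaussian_map fun L => ?_
    classical
    -- A linear functional of a finite-dimensional marginal is `W` of a single vector, hence
    -- Gaussian.
    have hL : (fun ω => L (I.restrict fun μ => W (T μ) ω)) =ᵐ[P']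
        W (∑ i : I, L (Pi.single i 1) • T i) := by
      rw [map_sum]
      have h1 : ∀ᵐ ω ∂P', ∀ i : I, W (L (Pi.single i 1) • T i) ω =
          L (Pi.single i 1) * W (T i) ω := by
        rw [ae_all_iff]
        intro i
        rw [map_smul]
        exact Lp.coeFn_smul _ _
      filter_upwards [coeFn_Lp_sum Finset.univ fun i : I => W (L (Pi.single i 1) • T i), h1]
        with ω h2 h3
      rw [h2, Finset.sum_congr rfl fun i _ => h3 i]
      have h4 := LinearMap.pi_apply_eq_sum_univ L.toLinearMap (I.restrict fun μ => W (T μ) ω)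
      refine h4.trans (Finset.sum_congr rfl fun i _ => ?_)
      have h5 : (fun j => if i = j then (1 : ℝ) else 0) = Pi.single i 1 := by
        ext j
        simp [Pi.single_apply, eq_comm]
      rw [h5, smul_eq_mul, mul_comm]
      rfl
    rw [AEMeasurable.map_map_of_aemeasurable (by fun_prop) hm, Function.comp_def,
      Measure.map_congr hL, hW]
    infer_instance
  · rw [covariance_eq_sub (Lp.memLp _) (Lp.memLp _), hmean, zero_mul, sub_zero]
    have h1 : ∫ ω, (W (T μ) * W (T ν) : Ω' → ℝ) ω ∂P' = inner ℝ (W (T ν)) (W (T μ)) := by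
      rw [L2.inner_def]
      rfl
    rw [h1, W.inner_map_map, L2.inner_def]
    refine integral_congr_ae ?_
    filter_upwards [hTT μ, hTT ν] with x h2 h3
    rw [h2, h3]
    rfl
  · simp only [hTlin, map_add, map_smul]
    filter_upwards [Lp.coeFn_add (a • W (T μ)) (b • W (T ν)), Lp.coeFn_smul a (W (T μ)),
      Lp.coeFn_smul b (W (T ν))] with ω h1 h2 h3
    rw [h1, Pi.add_apply, h2, h3]
    rfl

/-! ### Convergence in distribution from characteristic functions. -/

theorem charFun_map_toLp {Ω : Type*} [MeasurableSpace Ω] {P : Measure Ω} {k : ℕ}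
    {V : Ω → Fin k → ℝ} (hV : AEMeasurable V P) (a : EuclideanSpace ℝ (Fin k)) :
    charFun (P.map fun ω => WithLp.toLp 2 (V ω)) a =
      ∫ ω, Complex.exp ((∑ j, a j * V ω j : ℝ) * Complex.I) ∂P := by
  rw [charFun_apply, integral_map (by fun_prop) (by fun_prop)]
  simp [PiLp.inner_apply]

/-- Lévy's continuity theorem together with the Cramér–Wold device, along a countably generated
filter and with varying probability spaces. -/
theorem tendstoInDistribution_of_tendsto_cexp {ι Ω' : Type*} {Ω : ι → Type*}
    [∀ i, MeasurableSpace (Ω i)] [MeasurableSpace Ω'] {l : Filter ι} [l.IsCountablyGenerated]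
    {P : (i : ι) → Measure (Ω i)} [∀ i, IsProbabilityMeasure (P i)] {P' : Measure Ω'}
    [IsProbabilityMeasure P'] {k : ℕ} {Y : (i : ι) → Ω i → Fin k → ℝ} {Z : Ω' → Fin k → ℝ}
    (hY : ∀ i, AEMeasurable (Y i) (P i)) (hZ : AEMeasurable Z P')
    (h : ∀ a : Fin k → ℝ,
      Tendsto (fun i => ∫ ω, Complex.exp ((∑ j, a j * Y i ω j : ℝ) * Complex.I) ∂P i) l
        (𝓝 (∫ ω, Complex.exp ((∑ j, a j * Z ω j : ℝ) * Complex.I) ∂P'))) :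
    TendstoInDistribution Y l Z P P' := by
  have hE : TendstoInDistribution (fun i ω => (WithLp.toLp 2 (Y i ω) : EuclideanSpace ℝ (Fin k))) l
      (fun ω => WithLp.toLp 2 (Z ω)) P P' := by
    refine ⟨fun i => by have := hY i; fun_prop, by fun_prop, ?_⟩
    -- Lévy's theorem is applied along sequences; countable generation of `l` makes these
    -- sufficient.
    refine tendsto_of_seq_tendsto fun x hx => ?_
    refine ProbabilityMeasure.tendsto_of_tendsto_charFun fun a => ?_
    have := (h a).comp hx
    simp only [ProbabilityMeasure.coe_mk]
    rw [charFun_map_toLp hZ]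
    exact this.congr fun n => (charFun_map_toLp (hY _) a).symm
  exact hE.continuous_comp (g := WithLp.ofLp) (by fun_prop)

theorem coe_sum_smul_apply {k : ℕ} (a : Fin k → ℝ) (t : Fin k → MP) (A : Set (ℝ × ℝ)) :
    ((∑ j, a j • t j : MP) : SignedMeasure (ℝ × ℝ)) A =
      ∑ j, a j * (t j : SignedMeasure (ℝ × ℝ)) A := by
  simp

/-! ### Linearity of `X` and `J`: reduction to a single measure. -/

section GaussianField

variable {Ω' : Type*} [MeasurableSpace Ω'] {P' : Measure Ω'}
  {X : MP → Ω' → ℝ} {C : MP → MP → ℝ}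

theorem IsCentredGaussianLinearField.sum_smul (hX : IsCentredGaussianLinearField X C P')
    {ι : Type*} (s : Finset ι) (a : ι → ℝ) (t : ι → MP) :
    X (∑ j ∈ s, a j • t j) =ᵐ[P'] fun ω => ∑ j ∈ s, a j * X (t j) ω := by
  classical
  induction s using Finset.induction_on with
  | empty =>
    -- Linearity with zero coefficients gives `X 0 = 0` almost surely.
    have h := hX.linear 0 0 0 0
    simpa using h
  | insert i s hi ih =>
    have h := hX.linear (a i) 1 (t i) (∑ j ∈ s, a j • t j)
    rw [one_smul] at h
    rw [Finset.sum_insert hi]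
    filter_upwards [h, ih] with ω h1 h2
    rw [h1, h2, Finset.sum_insert hi, one_mul]

theorem IsCentredGaussianLinearField.integral_cexp (hX : IsCentredGaussianLinearField X C P')
    (μ : MP) : ∫ ω, Complex.exp ((X μ ω : ℝ) * Complex.I) ∂P' =
      Complex.exp (-((C μ μ : ℝ) : ℂ) / 2) := by
  have hg := hX.gaussian.hasGaussianLaw_eval μ
  have hv : Var[X μ; P'] = C μ μ := by
    rw [← covariance_self hg.aemeasurable, hX.covariance_eq]
  have h1 := charFun_gaussianReal (μ := ∫ ω, X μ ω ∂P') (v := Var[X μ; P'].toNNReal) 1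
  rw [← hg.map_eq_gaussianReal, charFun_apply, integral_map hg.aemeasurable (by fun_prop),
    Real.coe_toNNReal _ (variance_nonneg _ _), hX.centred, hv] at h1
  simpa [neg_div] using h1

end GaussianField

section CentredIntegral

theorem J_eq_integral_boxIntegral {Ω : Type*} (N : Ω → Measure ((ℝ × ℝ) × (ℝ × ℝ))) (μ : MP) :
    J N (μ : SignedMeasure (ℝ × ℝ)) = fun ω => ∫ p, boxIntegral (density μ) p ∂N ω := by
  ext ω
  simp_rw [J, (density_spec μ).apply_box]

variable {Ω : Type*} [MeasurableSpace Ω] {P : Measure Ω} [IsProbabilityMeasure P]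
  {N : Ω → Measure ((ℝ × ℝ) × (ℝ × ℝ))} {n : Measure ((ℝ × ℝ) × (ℝ × ℝ))}

theorem integrable_J (hN : IsPoissonRandomMeasure N n P)
    (hi : ∀ μ : MP, Integrable (boxIntegral (density μ)) n) (μ : MP) :
    Integrable (J N (μ : SignedMeasure (ℝ × ℝ))) P := by
  rw [J_eq_integral_boxIntegral]
  exact hN.integrable_integral (hi μ)

/-- Only an almost sure identity: splitting the Bochner integral needs each integrand to be
integrable against `N ω`. -/
theorem centredJ_sum_smul (hN : IsPoissonRandomMeasure N n P)
    (hi : ∀ μ : MP, Integrable (boxIntegral (density μ)) n) {k : ℕ} (a : Fin k → ℝ)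
    (t : Fin k → MP) :
    centredJ P N ((∑ j, a j • t j : MP) : SignedMeasure (ℝ × ℝ)) =ᵐ[P]
      fun ω => ∑ j, a j * centredJ P N (t j : SignedMeasure (ℝ × ℝ)) ω := by
  have hJ : J N ((∑ j, a j • t j : MP) : SignedMeasure (ℝ × ℝ)) =ᵐ[P]
      fun ω => ∑ j, a j * J N (t j : SignedMeasure (ℝ × ℝ)) ω := by
    have hall : ∀ᵐ ω ∂P, ∀ j, Integrable
        (fun p : (ℝ × ℝ) × (ℝ × ℝ) => (t j : SignedMeasure (ℝ × ℝ)) (box p.1 p.2)) (N ω) := by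
      rw [ae_all_iff]
      intro j
      filter_upwards [hN.ae_integrable (hi (t j))] with ω h
      exact h.congr (ae_of_all _ fun p => ((density_spec (t j)).apply_box p).symm)
    filter_upwards [hall] with ω h
    simp_rw [J, coe_sum_smul_apply]
    rw [integral_finsetSum _ fun j _ => (h j).const_mul _]
    simp_rw [integral_const_mul]
  have hE : ∫ ω, J N ((∑ j, a j • t j : MP) : SignedMeasure (ℝ × ℝ)) ω ∂P =
      ∑ j, a j * ∫ ω, J N (t j : SignedMeasure (ℝ × ℝ)) ω ∂P := by
    rw [integral_congr_ae hJ, integral_finsetSum _ fun j _ => (integrable_J hN hi (t j)).const_mul _]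
    simp_rw [integral_const_mul]
  filter_upwards [hJ] with ω h
  simp_rw [centredJ]
  rw [h, hE, ← Finset.sum_sub_distrib]
  simp_rw [mul_sub]

theorem integral_cexp_centredJ_div (hN : IsPoissonRandomMeasure N n P)
    (hi : ∀ μ : MP, Integrable (boxIntegral (density μ)) n) (μ : MP) (c : ℝ) :
    ∫ ω, Complex.exp ((centredJ P N (μ : SignedMeasure (ℝ × ℝ)) ω / c : ℝ) * Complex.I) ∂P =
      Complex.exp (∫ p, (Complex.exp ((boxIntegral (density μ) p / c : ℝ) * Complex.I) - 1 -
        (boxIntegral (density μ) p / c : ℝ) * Complex.I) ∂n) := by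
  have h := hN.integral_cexp_centred (g := fun p => boxIntegral (density μ) p / c)
    ((measurable_boxIntegral (density_spec μ).continuous).div_const c) ((hi μ).div_const c)
  rw [← h]
  simp_rw [centredJ, J_eq_integral_boxIntegral, integral_div, sub_div]

end CentredIntegral

end RandomBoxes

end

/-! ### The main theorem. -/

theorem mainTheorem6
    (f₁ f₂ : ℝ → ℝ) (hf₁ : Measurable f₁) (hf₂ : Measurable f₂)
    (hf₁_nonneg : ∀ u > 0, 0 ≤ f₁ u) (hf₂_nonneg : ∀ u > 0, 0 ≤ f₂ u)
    (hF : IsProbabilityMeasure (RandomBoxes.edgeLaw f₁ f₂))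
    (hv₁ : IntegrableOn (fun u => u ^ 2 * f₁ u) (Set.Ioi (0 : ℝ)))
    (hv₂ : IntegrableOn (fun u => u ^ 2 * f₂ u) (Set.Ioi (0 : ℝ)))
    (lam : Set.Ioi (0 : ℝ) → ℝ) (hlam_pos : ∀ ρ, 0 < lam ρ)
    (hlam : Tendsto lam (comap Subtype.val (𝓝 (0 : ℝ))) atTop)
    {Ω : Set.Ioi (0 : ℝ) → Type*} [∀ ρ, MeasurableSpace (Ω ρ)]
    (P : (ρ : Set.Ioi (0 : ℝ)) → Measure (Ω ρ)) [∀ ρ, IsProbabilityMeasure (P ρ)]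
    (N : (ρ : Set.Ioi (0 : ℝ)) → Ω ρ → Measure ((ℝ × ℝ) × (ℝ × ℝ)))
    (hN : ∀ ρ, RandomBoxes.IsPoissonRandomMeasure (N ρ)
      (RandomBoxes.intensity (RandomBoxes.edgeLaw f₁ f₂) (lam ρ) ρ) (P ρ)) :
    -- the fields are well defined, and so is the covariance function
    (∀ (ρ : Set.Ioi (0 : ℝ)) (μ : RandomBoxes.MP),
      (∀ᵐ ω ∂(P ρ), Integrable
        (fun p : (ℝ × ℝ) × (ℝ × ℝ) =>
          (μ : SignedMeasure (ℝ × ℝ)) (RandomBoxes.box p.1 p.2)) (N ρ ω)) ∧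
      Integrable (RandomBoxes.J (N ρ) (μ : SignedMeasure (ℝ × ℝ))) (P ρ)) ∧
    (∀ μ ν : RandomBoxes.MP,
      Integrable (fun x => RandomBoxes.density μ x * RandomBoxes.density ν x)) ∧
    -- the limiting field exists
    (∃ (Ω' : Type) (_ : MeasurableSpace Ω') (P' : Measure Ω') (X : RandomBoxes.MP → Ω' → ℝ),
      IsProbabilityMeasure P' ∧
      RandomBoxes.IsCentredGaussianLinearField X
        (fun μ ν => ∫ x, RandomBoxes.density μ x * RandomBoxes.density ν x) P') ∧
    -- convergence of the finite-dimensional distributions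
    (∀ (Ω' : Type*) [MeasurableSpace Ω'] (P' : Measure Ω') [IsProbabilityMeasure P']
      (X : RandomBoxes.MP → Ω' → ℝ),
      RandomBoxes.IsCentredGaussianLinearField X
        (fun μ ν => ∫ x, RandomBoxes.density μ x * RandomBoxes.density ν x) P' →
      RandomBoxes.TendstoFiniteDimensional
        (fun ρ (μ : RandomBoxes.MP) ω =>
          RandomBoxes.centredJ (P ρ) (N ρ) (μ : SignedMeasure (ℝ × ℝ)) ω /
            ((ρ : ℝ) ^ 2 * √(lam ρ * RandomBoxes.secondMoment f₁ * RandomBoxes.secondMoment f₂)))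
        (comap Subtype.val (𝓝 (0 : ℝ))) X P P') := by
  obtain ⟨hfin₁, hfin₂, hne₁, hne₂⟩ : IsFiniteMeasure (RandomBoxes.edgeMarginal f₁) ∧
      IsFiniteMeasure (RandomBoxes.edgeMarginal f₂) ∧ RandomBoxes.edgeMarginal f₁ ≠ 0 ∧
      RandomBoxes.edgeMarginal f₂ ≠ 0 := by
    have : IsProbabilityMeasure
        ((RandomBoxes.edgeMarginal f₁).prod (RandomBoxes.edgeMarginal f₂)) := by
      rwa [← RandomBoxes.edgeLaw_eq_prod hf₁ hf₂ hf₁_nonneg]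
    exact RandomBoxes.isFiniteMeasure_of_prod
  rw [RandomBoxes.edgeLaw_eq_prod hf₁ hf₂ hf₁_nonneg] at hN
  have hp₁ := RandomBoxes.edgeMarginal_ae_pos f₁
  have hp₂ := RandomBoxes.edgeMarginal_ae_pos f₂
  have hi₁ := RandomBoxes.integrable_sq_edgeMarginal hf₁ hf₁_nonneg hv₁
  have hi₂ := RandomBoxes.integrable_sq_edgeMarginal hf₂ hf₂_nonneg hv₂
  have hm₁ := RandomBoxes.integral_sq_edgeMarginal hf₁ hf₁_nonneg
  have hm₂ := RandomBoxes.integral_sq_edgeMarginal hf₂ hf₂_nonneg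
  have hpos₁ := RandomBoxes.integral_sq_pos hne₁ hp₁ hi₁
  have hpos₂ := RandomBoxes.integral_sq_pos hne₂ hp₂ hi₂
  rw [hm₁] at hpos₁
  rw [hm₂] at hpos₂
  have hint : ∀ (ρ : Set.Ioi (0 : ℝ)) (μ : RandomBoxes.MP),
      Integrable (RandomBoxes.boxIntegral (RandomBoxes.density μ)) (RandomBoxes.intensity
        ((RandomBoxes.edgeMarginal f₁).prod (RandomBoxes.edgeMarginal f₂)) (lam ρ) ρ) := by
    intro ρ μ
    obtain ⟨D, hD0, hD⟩ := (RandomBoxes.density_spec μ).exists_decay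
    exact RandomBoxes.integrable_boxIntegral_intensity (RandomBoxes.density_spec μ).continuous hD0
      hD hp₁ hp₂ hi₁ hi₂ (lam ρ) ρ.2
  refine ⟨fun ρ μ => ⟨?_, RandomBoxes.integrable_J (hN ρ) (hint ρ) μ⟩,
    RandomBoxes.integrable_density_mul, RandomBoxes.exists_gaussian_field, ?_⟩
  · filter_upwards [(hN ρ).ae_integrable (hint ρ μ)] with ω h
    exact h.congr (ae_of_all _ fun p => ((RandomBoxes.density_spec μ).apply_box p).symm)
  · intro Ω' _ P' _ X hX k t
    refine RandomBoxes.tendstoInDistribution_of_tendsto_cexp (fun ρ => ?_) ?_ fun a => ?_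
    · exact aemeasurable_pi_lambda _ fun j =>
        ((RandomBoxes.integrable_J (hN ρ) (hint ρ) (t j)).1.aemeasurable.sub_const _).div_const _
    · exact aemeasurable_pi_lambda _ fun j => hX.gaussian.aemeasurable (t j)
    · have hZ : ∫ ω, Complex.exp ((∑ j, a j * X (t j) ω : ℝ) * Complex.I) ∂P' =
          ∫ ω, Complex.exp ((X (∑ j, a j • t j) ω : ℝ) * Complex.I) ∂P' :=
        integral_congr_ae (by
          filter_upwards [hX.sum_smul Finset.univ a t] with ω h
          rw [h])
      rw [hZ, hX.integral_cexp]
      -- The Cramér–Wold coefficients are absorbed into one measure, so the one-dimensional exponent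
      -- limit is enough.
      set μ : RandomBoxes.MP := ∑ j, a j • t j with hμ
      obtain ⟨D, hD0, hD⟩ := (RandomBoxes.density_spec μ).exists_decay
      have hexp := RandomBoxes.tendsto_exponent (l := comap Subtype.val (𝓝 (0 : ℝ)))
        (ρ := fun ρ : Set.Ioi (0 : ℝ) => (ρ : ℝ)) (fun ρ => ρ.2) tendsto_comap hlam_pos hlam
        (RandomBoxes.density_spec μ).continuous (RandomBoxes.density_spec μ).integrable hD
        hp₁ hp₂ hi₁ hi₂ hm₁ hm₂ hpos₁ hpos₂
      refine ((Complex.continuous_exp.tendsto _).comp hexp).congr fun ρ => ?_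
      rw [Function.comp_apply, ← RandomBoxes.integral_cexp_centredJ_div (hN ρ) (hint ρ)]
      refine integral_congr_ae ?_
      filter_upwards [RandomBoxes.centredJ_sum_smul (hN ρ) (hint ρ) a t] with ω h
      rw [hμ, h, Finset.sum_div]
      simp_rw [mul_div_assoc]
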